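/- Let $\mathbb{Z}^2$ denote the square lattice (the Cayley graph of the group $\mathbb{Z}^2$ with generators $(1,0),(0,1)$). Let $\mu$ be a translation-invariant edge percolation measure on $\mathbb{Z}^2$, that is, a probability measure on $\{0,1\}^{E(\mathbb{Z}^2)}$ (with the product $\sigma$-algebra) that is invariant under the translation action of $\mathbb{Z}^2$. Identify a configuration with the spanning subgraph of its open edges (those with value $1$); its clusters are the connected components of this subgraph. Let $\mu^*$ be the dual measure on configurations on the planar dual graph: the vertices of the dual graph are the plaquettes (unit square faces) of $\mathbb{Z}^2$, each edge $e$ of $\mathbb{Z}^2$ corresponds to the dual edge $e^*$ joining the two plaquettes touching $e$, and $\mu^*$ is the law of the configuration $\omega^*$ given by $\omega^*_{e^*} = 1-\omega_e$, where $\omega$ has law $\mu$. Then $\mu$ has infinitely many infinite clusters with positive probability if and only if $\mu^*$ has infinitely many infinite clusters with positive probability. -/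

import Mathlib

open MeasureTheory

namespace Percolation

/-! ### Edge percolation on a graph -/

section Graph

variable {V : Type*} (G : SimpleGraph V)

/-- Configurations on `G`, that is, elements of `{0,1}^{E(G)}`: `true` is open, `false` is closed.
The product σ-algebra is the one Mathlib puts on a function type. -/
abbrev Config : Type _ := G.edgeSet → Bool

variable {G}

/-- The spanning subgraph of `G` whose edges are the open edges of `ω`. -/
def openSubgraph (ω : Config G) : SimpleGraph V :=
  SimpleGraph.fromEdgeSet {e | ∃ h : e ∈ G.edgeSet, ω ⟨e, h⟩ = true}

/-- A cluster is a connected component of the open subgraph. -/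
abbrev Cluster (ω : Config G) : Type _ := (openSubgraph ω).ConnectedComponent

/-- `ω` has infinitely many infinite clusters. -/
def HasInfinitelyManyInfiniteClusters (ω : Config G) : Prop :=
  {C : Cluster ω | C.supp.Infinite}.Infinite

end Graph

/-! ### The square lattice and its translations -/

/-- The square lattice: the Cayley graph of `ℤ²` with generators `(1,0)` and `(0,1)`. -/
def squareLattice : SimpleGraph (ℤ × ℤ) :=
  SimpleGraph.addCayley {((1 : ℤ), (0 : ℤ)), ((0 : ℤ), (1 : ℤ))}

theorem squareLattice_adj (u v : ℤ × ℤ) :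
    squareLattice.Adj u v ↔
      (u.2 = v.2 ∧ (v.1 = u.1 + 1 ∨ u.1 = v.1 + 1)) ∨
      (u.1 = v.1 ∧ (v.2 = u.2 + 1 ∨ u.2 = v.2 + 1)) := by
  obtain ⟨a, b⟩ := u
  obtain ⟨c, d⟩ := v
  simp only [squareLattice, SimpleGraph.addCayley_adj', Set.mem_insert_iff,
    Set.mem_singleton_iff, exists_eq_or_imp, exists_eq_left, Prod.mk_add_mk, Prod.mk.injEq, ne_eq]
  omega

/-- Translation by `t`, as an automorphism of the square lattice. -/
def translation (t : ℤ × ℤ) : squareLattice ≃g squareLattice where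
  toEquiv := Equiv.addRight t
  map_rel_iff' := by
    intro u v
    simp only [squareLattice_adj, Equiv.coe_addRight, Prod.fst_add, Prod.snd_add]
    omega

/-- The action of `ℤ²` on configurations: the edge `e + t` is open in the translate of `ω` by `t`
if and only if `e` is open in `ω`. -/
def translate (t : ℤ × ℤ) (ω : Config squareLattice) : Config squareLattice :=
  fun e => ω ((translation t).mapEdgeSet.symm e)

/-- A measure on configurations is translation-invariant if every translation preserves it. -/
def TranslationInvariant (μ : Measure (Config squareLattice)) : Prop :=
  ∀ t : ℤ × ℤ, MeasurePreserving (translate t) μ μ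

/-! ### Planar duality -/

/-- The plaquettes (faces) of the square lattice. The point `(x, y)` stands for the unit square
`[x, x+1] × [y, y+1]`, whose centre is `(x + 1/2, y + 1/2)`. -/
abbrev Plaquette : Type := ℤ × ℤ

/-- The four corners of a plaquette. -/
def Plaquette.corners (p : Plaquette) : Set (ℤ × ℤ) := Set.Icc p (p + (1, 1))

/-- The plaquette `p` touches the edge `e`: the edge is one of the four sides of the square. -/
def Plaquette.Touches (p : Plaquette) (e : squareLattice.edgeSet) : Prop :=
  ∀ v ∈ e.1, v ∈ p.corners

/-- The planar dual of the square lattice: its vertices are the plaquettes, and two distinct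
plaquettes are joined if they touch a common edge. -/
def dualLattice : SimpleGraph Plaquette where
  Adj p q := p ≠ q ∧ ∃ e : squareLattice.edgeSet, p.Touches e ∧ q.Touches e
  symm := ⟨fun _ _ ⟨h, e, hp, hq⟩ => ⟨h.symm, e, hq, hp⟩⟩
  loopless := ⟨fun _ h => h.1 rfl⟩

theorem dualLattice_adj (p q : Plaquette) : dualLattice.Adj p q ↔ squareLattice.Adj p q := by
  rw [squareLattice_adj]
  obtain ⟨a, b⟩ := p
  obtain ⟨c, d⟩ := q
  constructor
  · rintro ⟨hne, ⟨e, he⟩, hp, hq⟩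
    induction e using Sym2.ind with
    | _ u v =>
      obtain ⟨u1, u2⟩ := u
      obtain ⟨v1, v2⟩ := v
      rw [SimpleGraph.mem_edgeSet, squareLattice_adj] at he
      simp only [Plaquette.Touches, Plaquette.corners, Sym2.mem_iff, forall_eq_or_imp, forall_eq,
        Set.mem_Icc, Prod.mk_le_mk, Prod.mk_add_mk, ne_eq, Prod.mk.injEq] at hp hq hne he ⊢
      omega
  · intro h
    have he : s((a, b) ⊔ (c, d), (a, b) ⊓ (c, d) + ((1 : ℤ), (1 : ℤ))) ∈ squareLattice.edgeSet := by
      rw [SimpleGraph.mem_edgeSet, squareLattice_adj]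
      simp only [Prod.mk_sup_mk, Prod.mk_inf_mk, Prod.mk_add_mk] at h ⊢
      omega
    refine ⟨?_, ⟨_, he⟩, ?_⟩
    · simp only [ne_eq, Prod.mk.injEq] at h ⊢
      omega
    · simp only [Plaquette.Touches, Plaquette.corners, Sym2.mem_iff, forall_eq_or_imp, forall_eq,
        Set.mem_Icc, Prod.mk_le_mk, Prod.mk_add_mk, Prod.mk_sup_mk, Prod.mk_inf_mk] at h ⊢
      omega

/-- The natural identification of `E(ℤ²)` with the edge set of the planar dual. The edge `{u, v}`
corresponds to the dual edge that joins the two plaquettes touching it; the lower left corners of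
these are `u ⊓ v` and `u ⊔ v - (1, 1)`, with componentwise minimum and maximum. -/
def dualEdge : squareLattice.edgeSet ≃ dualLattice.edgeSet where
  toFun e := ⟨s(e.1.inf, e.1.sup - (1, 1)), by
    obtain ⟨e, he⟩ := e
    induction e using Sym2.ind with
    | _ u v =>
      obtain ⟨u1, u2⟩ := u
      obtain ⟨v1, v2⟩ := v
      rw [SimpleGraph.mem_edgeSet, squareLattice_adj] at he
      rw [SimpleGraph.mem_edgeSet, dualLattice_adj, squareLattice_adj]
      simp only [Sym2.inf_mk, Sym2.sup_mk, Prod.mk_sup_mk, Prod.mk_inf_mk, Prod.mk_sub_mk] at he ⊢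
      omega⟩
  invFun f := ⟨s(f.1.sup, f.1.inf + (1, 1)), by
    obtain ⟨e, he⟩ := f
    induction e using Sym2.ind with
    | _ u v =>
      obtain ⟨u1, u2⟩ := u
      obtain ⟨v1, v2⟩ := v
      rw [SimpleGraph.mem_edgeSet, dualLattice_adj, squareLattice_adj] at he
      rw [SimpleGraph.mem_edgeSet, squareLattice_adj]
      simp only [Sym2.inf_mk, Sym2.sup_mk, Prod.mk_sup_mk, Prod.mk_inf_mk, Prod.mk_add_mk] at he ⊢
      omega⟩
  left_inv e := by
    obtain ⟨e, he⟩ := e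
    induction e using Sym2.ind with
    | _ u v =>
      obtain ⟨u1, u2⟩ := u
      obtain ⟨v1, v2⟩ := v
      rw [SimpleGraph.mem_edgeSet, squareLattice_adj] at he
      simp only [Sym2.inf_mk, Sym2.sup_mk, Prod.mk_sup_mk, Prod.mk_inf_mk, Prod.mk_sub_mk,
        Prod.mk_add_mk, Subtype.mk.injEq, Sym2.eq_iff, Prod.mk.injEq] at he ⊢
      omega
  right_inv f := by
    obtain ⟨e, he⟩ := f
    induction e using Sym2.ind with
    | _ u v =>
      obtain ⟨u1, u2⟩ := u
      obtain ⟨v1, v2⟩ := v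
      rw [SimpleGraph.mem_edgeSet, dualLattice_adj, squareLattice_adj] at he
      simp only [Sym2.inf_mk, Sym2.sup_mk, Prod.mk_sup_mk, Prod.mk_inf_mk, Prod.mk_sub_mk,
        Prod.mk_add_mk, Subtype.mk.injEq, Sym2.eq_iff, Prod.mk.injEq] at he ⊢
      omega

/-- The ends of the dual edge of `e` are exactly the plaquettes that touch `e`. -/
theorem mem_dualEdge_iff (e : squareLattice.edgeSet) (p : Plaquette) :
    p ∈ (dualEdge e).1 ↔ p.Touches e := by
  obtain ⟨e, he⟩ := e
  obtain ⟨a, b⟩ := p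
  induction e using Sym2.ind with
  | _ u v =>
    obtain ⟨u1, u2⟩ := u
    obtain ⟨v1, v2⟩ := v
    rw [SimpleGraph.mem_edgeSet, squareLattice_adj] at he
    simp only [dualEdge, Equiv.coe_fn_mk, Plaquette.Touches, Plaquette.corners, Sym2.mem_iff,
      forall_eq_or_imp, forall_eq, Set.mem_Icc, Prod.mk_le_mk, Prod.mk_add_mk, Sym2.inf_mk,
      Sym2.sup_mk, Prod.mk_sup_mk, Prod.mk_inf_mk, Prod.mk_sub_mk, Prod.mk.injEq] at he ⊢
    omega

/-- The dual of a configuration: a dual edge is open if and only if the edge it crosses is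
closed. -/
def dualConfig (ω : Config squareLattice) : Config dualLattice :=
  fun f => !ω (dualEdge.symm f)

theorem measurable_dualConfig : Measurable dualConfig :=
  measurable_pi_lambda _ fun f => (measurable_of_countable Bool.not).comp
    (measurable_pi_apply (dualEdge.symm f))

/-- The dual measure `μ*`: the law of the dual of a configuration with law `μ`. -/
noncomputable def dualMeasure (μ : Measure (Config squareLattice)) : Measure (Config dualLattice) :=
  μ.map dualConfig

end Percolation

/-! The deterministic half is planar. If a graph `G` has `N + 1` infinite clusters, then some finite
set `K` of plaquettes leaves at least `N` infinite components of the dual graph `H` off `K`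
(`IsPlanarDual.exists_infinite_components`). Join one cluster to each of the others by lattice
paths, and let `K` contain the plaquettes beside them. The edge boundary of a union of clusters
crosses only closed edges, so it consists of open dual edges, evenly many at each plaquette. Record,
for each component of `H` off `K`, the parity of the boundary edges joining it to `K`. This parity
is zero for finite components and is additive in the union modulo two. With fewer than `N` infinite
components, linear algebra over `ZMod 2` would give a union that separates the base cluster from
another one and has all parities zero. That is impossible. Rays to infinity inside the two separated
clusters, closed up by the path between them, form a cycle modulo two, hence bound a set `σ` of
plaquettes. The boundary of the union misses the rays and meets the path an odd number of times.
Since `σ` is constant on each component of `H` off `K`, summation by parts produces a component with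
odd parity.

The probabilistic half is a Burton–Keane argument (`ae_not_branching`): almost surely no finite
connected set has three infinite components around it. Disjoint branching sets in a box number at
most a constant times its perimeter, while invariance would make their expected number proportional
to its area. Hence a finite set splits each infinite cluster of `H` into at most two infinite
components, and `M` infinite clusters of `H` allow `N ≤ 2 * M` only.

The converse follows by exchanging roles, since the double dual is the original graph shifted by
`(1, 1)`. -/

namespace Percolation

/-! ### Restricted graphs, branching sets and their deterministic count -/

section Graph

variable {V : Type*}

/-- The graph of all edges of `G` that have both ends in `S`. -/
def restrictTo (G : SimpleGraph V) (S : Set V) : SimpleGraph V where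
  Adj u v := G.Adj u v ∧ u ∈ S ∧ v ∈ S
  symm := ⟨fun _ _ h => ⟨h.1.symm, h.2.2, h.2.1⟩⟩
  loopless := ⟨fun _ h => G.irrefl h.1⟩

theorem restrictTo_le (G : SimpleGraph V) (S : Set V) : restrictTo G S ≤ G := fun _ _ h => h.1

theorem restrictTo_mono (G : SimpleGraph V) {S T : Set V} (h : S ⊆ T) :
    restrictTo G S ≤ restrictTo G T := fun _ _ ⟨h1, h2, h3⟩ => ⟨h1, h h2, h h3⟩

/-- The step may use that `x` is already reachable from `u`, so facts about the whole component of
`u` are available along the walk. -/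
theorem reachable_induction {G : SimpleGraph V} {u v : V} {P : V → Prop} (h : G.Reachable u v)
    (h0 : P u) (hs : ∀ x y, G.Reachable u x → G.Adj x y → P x → P y) : P v := by
  rw [SimpleGraph.reachable_iff_reflTransGen] at h
  induction h with
  | refl => exact h0
  | tail hb hc ih => exact hs _ _ ((SimpleGraph.reachable_iff_reflTransGen _ _).2 hb) hc ih

theorem mem_of_reachable_restrictTo {G : SimpleGraph V} {S : Set V} {u v : V} (hu : u ∈ S)
    (h : (restrictTo G S).Reachable u v) : v ∈ S :=
  reachable_induction h hu fun _ _ _ h _ => h.2.2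

/-- A vertex outside `K` whose cluster meets `K` is connected off `K` to a neighbour of `K`. -/
theorem exists_adj_of_reachable {G : SimpleGraph V} {K : Set V} {u k : V} (hu : u ∉ K)
    (hk : k ∈ K) (h : G.Reachable u k) :
    ∃ v ∉ K, (∃ k ∈ K, G.Adj v k) ∧ (restrictTo G Kᶜ).Reachable u v := by
  -- Follow a walk until it first enters `K`; the vertex just before is the witness.
  have key : (∃ v ∉ K, (∃ k ∈ K, G.Adj v k) ∧ (restrictTo G Kᶜ).Reachable u v) ∨
      (k ∉ K ∧ (restrictTo G Kᶜ).Reachable u k) := by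
    refine reachable_induction (P := fun k => _ ∨ (k ∉ K ∧ (restrictTo G Kᶜ).Reachable u k)) h
      (Or.inr ⟨hu, SimpleGraph.Reachable.refl _⟩) ?_
    rintro x y - hxy (h | ⟨hx, hr⟩)
    · exact Or.inl h
    · by_cases hy : y ∈ K
      · exact Or.inl ⟨x, hx, ⟨y, hy, hxy⟩, hr⟩
      · exact Or.inr ⟨hy, hr.trans (SimpleGraph.Adj.reachable ⟨hxy, hx, hy⟩)⟩
  rcases key with h | h
  · exact h
  · exact absurd hk h.1

/-- A component off `K`, if it avoids `Z`, is connected off `Z`. -/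
theorem reachable_off_of_disjoint {G : SimpleGraph V} {K Z : Set V} {a x : V}
    (h : (restrictTo G Kᶜ).Reachable a x)
    (hZ : ∀ y, (restrictTo G Kᶜ).Reachable a y → y ∉ Z) : (restrictTo G Zᶜ).Reachable a x := by
  refine reachable_induction (P := fun x => (restrictTo G Zᶜ).Reachable a x) h
    (SimpleGraph.Reachable.refl _) ?_
  intro x y hx hxy hr
  exact hr.trans (SimpleGraph.Adj.reachable
    ⟨hxy.1, hZ x hx, hZ y (hx.trans (SimpleGraph.Adj.reachable hxy))⟩)

/-- A component off `K` together with the connected set `K` is connected off `Z`, if both avoid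
`Z`. -/
theorem reachable_off_of_branch {G : SimpleGraph V} {K Z : Set V} {a k k' x : V}
    (hK : ∀ u ∈ K, ∀ v ∈ K, (restrictTo G K).Reachable u v) (hKZ : Disjoint K Z)
    (hk : k ∈ K) (hk' : k' ∈ K) (hak : G.Adj a k)
    (hZ : ∀ y, (restrictTo G Kᶜ).Reachable a y → y ∉ Z)
    (h : (restrictTo G Kᶜ).Reachable a x) : (restrictTo G Zᶜ).Reachable x k' := by
  have h1 := (reachable_off_of_disjoint h hZ).symm
  have h2 : (restrictTo G Zᶜ).Adj a k :=
    ⟨hak, hZ a (SimpleGraph.Reachable.refl _), fun hz => Set.disjoint_left.1 hKZ hk hz⟩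
  have h3 : (restrictTo G Zᶜ).Reachable k k' :=
    (hK k hk k' hk').mono (restrictTo_mono G fun v hv hz => Set.disjoint_left.1 hKZ hv hz)
  exact h1.trans (h2.reachable.trans h3)

/-- `K` is a connected finite set of vertices, and removing it leaves at least three infinite
components that are adjacent to it. -/
def Branching (G : SimpleGraph V) (K : Finset V) : Prop :=
  (∀ u ∈ K, ∀ v ∈ K, (restrictTo G (K : Set V)).Reachable u v) ∧
  ∃ a : Fin 3 → V,
    (∀ i, a i ∉ K ∧ (∃ k ∈ K, G.Adj (a i) k) ∧
      {v | (restrictTo G (K : Set V)ᶜ).Reachable (a i) v}.Infinite) ∧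
    ∀ i j, i ≠ j → ¬ (restrictTo G (K : Set V)ᶜ).Reachable (a i) (a j)

/-- Two branches of a branching set that do not contain a given vertex. -/
theorem Branching.exists_two {G : SimpleGraph V} {K : Finset V} (h : Branching G K) (r : V) :
    ∃ l m : V,
      (∃ k ∈ K, G.Adj l k) ∧ (∃ k ∈ K, G.Adj m k) ∧
      {v | (restrictTo G (K : Set V)ᶜ).Reachable l v}.Infinite ∧
      {v | (restrictTo G (K : Set V)ᶜ).Reachable m v}.Infinite ∧
      ¬ (restrictTo G (K : Set V)ᶜ).Reachable l m ∧
      ¬ (restrictTo G (K : Set V)ᶜ).Reachable l r ∧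
      ¬ (restrictTo G (K : Set V)ᶜ).Reachable m r := by
  obtain ⟨-, a, ha, hd⟩ := h
  -- The three branches are distinct components, so at most one contains `r`.
  have key : ∃ i j, i ≠ j ∧ ¬ (restrictTo G (K : Set V)ᶜ).Reachable (a i) r ∧
      ¬ (restrictTo G (K : Set V)ᶜ).Reachable (a j) r := by
    by_contra! hcon
    have h01 := hcon 0 1 (by decide)
    have h02 := hcon 0 2 (by decide)
    have h12 := hcon 1 2 (by decide)
    have d01 := hd 0 1 (by decide)
    have d02 := hd 0 2 (by decide)
    have d12 := hd 1 2 (by decide)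
    by_cases h0 : (restrictTo G (K : Set V)ᶜ).Reachable (a 0) r
    · by_cases h1 : (restrictTo G (K : Set V)ᶜ).Reachable (a 1) r
      · exact d01 (h0.trans h1.symm)
      · exact d02 (h0.trans (h12 h1).symm)
    · exact d12 ((h01 h0).trans (h02 h0).symm)
  obtain ⟨i, j, hij, hi, hj⟩ := key
  exact ⟨a i, a j, (ha i).2.1, (ha j).2.1, (ha i).2.2, (ha j).2.2, hd i j hij, hi, hj⟩

/-- A laminar family of disjoint pairs of sets that all meet the finite set `Y` has at most `|Y|`
members. -/
theorem card_le_card_of_laminar {ι α : Type*} (I : Finset ι) (Y : Finset α) (L R : ι → Set α)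
    (hL : ∀ i ∈ I, ∃ y ∈ Y, y ∈ L i) (hR : ∀ i ∈ I, ∃ y ∈ Y, y ∈ R i)
    (hd : ∀ i ∈ I, Disjoint (L i) (R i))
    (hlam : ∀ i ∈ I, ∀ j ∈ I, i ≠ j → L i ∪ R i ⊆ L j ∨ L i ∪ R i ⊆ R j ∨
      L j ∪ R j ⊆ L i ∨ L j ∪ R j ⊆ R i ∨ Disjoint (L i ∪ R i) (L j ∪ R j)) :
    I.card ≤ Y.card := by
  classical
  induction hn : I.card generalizing I Y with
  | zero => exact Nat.zero_le _
  | succ n ih =>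
    have hne : I.Nonempty := Finset.card_pos.1 (by omega)
    -- Take a pair with the smallest trace on `Y` and remove it together with one point `y` of its
    -- left set. No other pair fits inside `L i`, since its trace would lose the point `z` of `R i`.
    obtain ⟨i, hi, hmin⟩ := Finset.exists_min_image I
      (fun i => (Y.filter (· ∈ L i ∪ R i)).card) hne
    obtain ⟨y, hyY, hyL⟩ := hL i hi
    obtain ⟨z, hzY, hzR⟩ := hR i hi
    have hdisj : ∀ j ∈ I, ∀ x, x ∈ L j → x ∈ R j → False :=
      fun j hj x h1 h2 => Set.disjoint_left.1 (hd j hj) h1 h2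
    have hzy : z ≠ y := fun h => hdisj i hi y hyL (h ▸ hzR)
    have hsmall : ∀ j ∈ I, ¬ L j ∪ R j ⊆ L i := by
      intro j hj hsub
      refine absurd (hmin j hj) (not_le.2 (Finset.card_lt_card ?_))
      refine Finset.ssubset_iff_of_subset (fun x hx => ?_) |>.2 ⟨z, ?_, ?_⟩
      · rw [Finset.mem_filter] at hx ⊢
        exact ⟨hx.1, Or.inl (hsub hx.2)⟩
      · exact Finset.mem_filter.2 ⟨hzY, Or.inr hzR⟩
      · intro hz
        exact hdisj i hi z (hsub (Finset.mem_filter.1 hz).2) hzR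
    have main : n ≤ (Y.erase y).card := by
      refine ih (I.erase i) (Y.erase y) ?_ ?_ (fun j hj => hd j (Finset.mem_of_mem_erase hj))
        (fun j hj k hk => hlam j (Finset.mem_of_mem_erase hj) k (Finset.mem_of_mem_erase hk)) ?_
      · intro j hj
        obtain ⟨hji, hj⟩ := Finset.mem_erase.1 hj
        obtain ⟨x, hxY, hx⟩ := hL j hj
        by_cases hxy : x = y
        · subst hxy
          -- If `L j` relied on the deleted `y`, laminarity leaves only that `L j` contains the
          -- whole pair `i`, and `z` replaces `y`.
          rcases hlam i hi j hj (Ne.symm hji) with h | h | h | h | h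
          · exact ⟨z, Finset.mem_erase.2 ⟨hzy, hzY⟩, h (Or.inr hzR)⟩
          · exact (hdisj j hj x hx (h (Or.inl hyL))).elim
          · exact (hsmall j hj h).elim
          · exact (hdisj i hi x hyL (h (Or.inl hx))).elim
          · exact (Set.disjoint_left.1 h (Or.inl hyL) (Or.inl hx)).elim
        · exact ⟨x, Finset.mem_erase.2 ⟨hxy, hxY⟩, hx⟩
      · intro j hj
        obtain ⟨hji, hj⟩ := Finset.mem_erase.1 hj
        obtain ⟨x, hxY, hx⟩ := hR j hj
        by_cases hxy : x = y
        · subst hxy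
          rcases hlam i hi j hj (Ne.symm hji) with h | h | h | h | h
          · exact (hdisj j hj x (h (Or.inl hyL)) hx).elim
          · exact ⟨z, Finset.mem_erase.2 ⟨hzy, hzY⟩, h (Or.inr hzR)⟩
          · exact (hsmall j hj h).elim
          · exact (hdisj i hi x hyL (h (Or.inr hx))).elim
          · exact (Set.disjoint_left.1 h (Or.inl hyL) (Or.inr hx)).elim
        · exact ⟨x, Finset.mem_erase.2 ⟨hxy, hxY⟩, hx⟩
      · rw [Finset.card_erase_of_mem hi]; omega
    rw [Finset.card_erase_of_mem hyY] at main
    have := Finset.card_pos.2 ⟨y, hyY⟩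
    omega

/-- If the branches `l`, `m` of `J` avoid the root, and the connected set `J` lies in the
branch `a` of `K`, which also avoids the root, then so do the branches of `J`. -/
theorem branch_subset {G : SimpleGraph V} {K J : Set V} {a l r kj ki x : V}
    (hK : ∀ u ∈ K, ∀ v ∈ K, (restrictTo G K).Reachable u v)
    (hJ : ∀ u ∈ J, ∀ v ∈ J, (restrictTo G J).Reachable u v)
    (hKJ : Disjoint K J) (hki : ki ∈ K) (hkj : kj ∈ J) (hrk : G.Reachable r ki)
    (ha : (restrictTo G Kᶜ).Reachable a kj) (har : ¬ (restrictTo G Kᶜ).Reachable a r)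
    (hl : ∃ k ∈ J, G.Adj l k) (hlr : ¬ (restrictTo G Jᶜ).Reachable l r)
    (hx : (restrictTo G Jᶜ).Reachable l x) : (restrictTo G Kᶜ).Reachable a x := by
  obtain ⟨k, hk, hlk⟩ := hl
  -- If the branch of `l` met `K`, it would contain all of the connected set `K`. The root either
  -- lies in `K` or is joined to `K` by a route avoiding `J`, since a route meeting `J` would place
  -- the root in the branch of `a`. Either way the branch of `l` would contain the root.
  by_cases hz : ∀ y, (restrictTo G Jᶜ).Reachable l y → y ∉ K
  · exact ha.trans (reachable_off_of_branch hJ hKJ.symm hk hkj hlk hz hx).symm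
  · exfalso
    push Not at hz
    obtain ⟨z, hlz, hzK⟩ := hz
    have hKoff : ∀ u ∈ K, (restrictTo G Jᶜ).Reachable l u := fun u hu =>
      hlz.trans ((hK z hzK u hu).mono
        (restrictTo_mono G fun v hv hz => Set.disjoint_left.1 hKJ hv hz))
    by_cases hrK : r ∈ K
    · exact hlr (hKoff r hrK)
    · obtain ⟨v, hvK, ⟨k', hk', hvk'⟩, hrv⟩ := exists_adj_of_reachable hrK hki hrk
      refine hlr ((hKoff ki hki).trans (reachable_off_of_branch hK hKJ hk' hki hvk' ?_ hrv.symm).symm)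
      intro y hvy hyJ
      have : (restrictTo G Kᶜ).Reachable kj y := (hJ kj hkj y hyJ).mono
        (restrictTo_mono G fun v hv hz => Set.disjoint_left.1 hKJ hz hv)
      exact har (ha.trans (this.trans (hvy.symm.trans hrv.symm)))

/-- Disjoint branching sets all of whose branches meet the finite set `Y` number at most `|Y|`. -/
theorem card_branching_le {ι : Type*} {G : SimpleGraph V} (I : Finset ι) (K : ι → Finset V)
    (Y : Finset V) (hK : ∀ i ∈ I, Branching G (K i))
    (hdisj : ∀ i ∈ I, ∀ j ∈ I, i ≠ j → Disjoint (K i : Set V) (K j : Set V))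
    (hY : ∀ i ∈ I, ∀ a, (∃ k ∈ K i, G.Adj a k) →
      {v | (restrictTo G (K i : Set V)ᶜ).Reachable a v}.Infinite →
      ∃ y ∈ Y, (restrictTo G (K i : Set V)ᶜ).Reachable a y) :
    I.card ≤ Y.card := by
  classical
  rcases I.eq_empty_or_nonempty with rfl | ⟨i₀, hi₀⟩
  · exact Nat.zero_le _
  have : Nonempty V := (hK i₀ hi₀).2.elim fun a _ => ⟨a 0⟩
  have hk0 : ∀ i, ∃ k, i ∈ I → k ∈ K i := by
    intro i
    by_cases hi : i ∈ I
    · obtain ⟨-, a, ha, -⟩ := hK i hi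
      obtain ⟨-, ⟨k, hk, -⟩, -⟩ := ha 0
      exact ⟨k, fun _ => hk⟩
    · exact ⟨Classical.arbitrary V, fun h => absurd h hi⟩
  choose k hk using hk0
  -- One root per cluster: branching sets in the same cluster discard branches relative to the same
  -- vertex, which is what makes the remaining pairs laminar.
  let root : V → V := fun v => (G.connectedComponentMk v).out
  have hroot : ∀ v, G.Reachable (root v) v := fun v =>
    SimpleGraph.ConnectedComponent.exact (Quot.out_eq (G.connectedComponentMk v))
  have hrooteq : ∀ u v, G.Reachable u v → root u = root v := fun u v h => by
    simp only [root, SimpleGraph.ConnectedComponent.sound h]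
  have h2 : ∀ i, ∃ l m : V, i ∈ I →
      (∃ k ∈ K i, G.Adj l k) ∧ (∃ k ∈ K i, G.Adj m k) ∧
      {v | (restrictTo G (K i : Set V)ᶜ).Reachable l v}.Infinite ∧
      {v | (restrictTo G (K i : Set V)ᶜ).Reachable m v}.Infinite ∧
      ¬ (restrictTo G (K i : Set V)ᶜ).Reachable l m ∧
      ¬ (restrictTo G (K i : Set V)ᶜ).Reachable l (root (k i)) ∧
      ¬ (restrictTo G (K i : Set V)ᶜ).Reachable m (root (k i)) := by
    intro i
    by_cases hi : i ∈ I
    · obtain ⟨l, m, h⟩ := (hK i hi).exists_two (root (k i))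
      exact ⟨l, m, fun _ => h⟩
    · exact ⟨k i, k i, fun h => absurd h hi⟩
  choose l m h2 using h2
  have hcon : ∀ i ∈ I, ∀ u ∈ (K i : Set V), ∀ v ∈ (K i : Set V),
      (restrictTo G (K i : Set V)).Reachable u v := fun i hi => (hK i hi).1
  refine card_le_card_of_laminar I Y
    (fun i => {v | (restrictTo G (K i : Set V)ᶜ).Reachable (l i) v})
    (fun i => {v | (restrictTo G (K i : Set V)ᶜ).Reachable (m i) v}) ?_ ?_ ?_ ?_
  · intro i hi
    exact hY i hi _ (h2 i hi).1 (h2 i hi).2.2.1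
  · intro i hi
    exact hY i hi _ (h2 i hi).2.1 (h2 i hi).2.2.2.1
  · intro i hi
    refine Set.disjoint_left.2 fun v hv hv' => (h2 i hi).2.2.2.2.1 ?_
    exact SimpleGraph.Reachable.trans hv (SimpleGraph.Reachable.symm hv')
  · intro i hi j hj hij
    obtain ⟨hli, hmi, -, -, -, hlri, hmri⟩ := h2 i hi
    obtain ⟨hlj, hmj, -, -, -, hlrj, hmrj⟩ := h2 j hj
    have hsame : ∀ a, (∃ k ∈ K i, G.Adj a k) →
        (restrictTo G (K i : Set V)ᶜ).Reachable a (k j) → root (k j) = root (k i) := by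
      rintro a ⟨k', hk', hak'⟩ ha
      refine hrooteq _ _ ((ha.mono (restrictTo_le _ _)).symm.trans (hak'.reachable.trans ?_))
      exact (hcon i hi k' hk' (k i) (hk i hi)).mono (restrictTo_le _ _)
    have hin : ∀ a, (∃ k ∈ K i, G.Adj a k) →
        ¬ (restrictTo G (K i : Set V)ᶜ).Reachable a (root (k i)) →
        (restrictTo G (K i : Set V)ᶜ).Reachable a (k j) → ∀ x,
        ((restrictTo G (K j : Set V)ᶜ).Reachable (l j) x ∨
          (restrictTo G (K j : Set V)ᶜ).Reachable (m j) x) →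
        (restrictTo G (K i : Set V)ᶜ).Reachable a x := by
      intro a ha har hak x hx
      have hs := hsame a ha hak
      rw [hs] at hlrj hmrj
      rcases hx with hx | hx
      · exact branch_subset (hcon i hi) (hcon j hj) (hdisj i hi j hj hij) (hk i hi) (hk j hj)
          (hroot (k i)) hak har hlj hlrj hx
      · exact branch_subset (hcon i hi) (hcon j hj) (hdisj i hi j hj hij) (hk i hi) (hk j hj)
          (hroot (k i)) hak har hmj hmrj hx
    by_cases hl : (restrictTo G (K i : Set V)ᶜ).Reachable (l i) (k j)
    · exact Or.inr (Or.inr (Or.inl (fun x hx => hin _ hli hlri hl x hx)))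
    by_cases hm : (restrictTo G (K i : Set V)ᶜ).Reachable (m i) (k j)
    · exact Or.inr (Or.inr (Or.inr (Or.inl (fun x hx => hin _ hmi hmri hm x hx))))
    -- Neither chosen branch of `K i` meets `K j`, so `K i` and both branches lie in a single
    -- component off `K j`. Either that component is a chosen branch of `K j`, or it is disjoint
    -- from both.
    have hout : ∀ x, ((restrictTo G (K i : Set V)ᶜ).Reachable (l i) x ∨
          (restrictTo G (K i : Set V)ᶜ).Reachable (m i) x) →
        (restrictTo G (K j : Set V)ᶜ).Reachable x (k i) := by
      have havoid : ∀ a, ¬ (restrictTo G (K i : Set V)ᶜ).Reachable a (k j) →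
          ∀ y, (restrictTo G (K i : Set V)ᶜ).Reachable a y → y ∉ (K j : Set V) := by
        intro a ha y hy hyj
        exact ha (hy.trans ((hcon j hj y hyj (k j) (hk j hj)).mono (restrictTo_mono G
          fun v hv hz => Set.disjoint_left.1 (hdisj i hi j hj hij) hz hv)))
      rintro x (hx | hx)
      · obtain ⟨k', hk', hlk'⟩ := hli
        exact reachable_off_of_branch (hcon i hi) (hdisj i hi j hj hij) hk' (hk i hi) hlk'
          (havoid _ hl) hx
      · obtain ⟨k', hk', hlk'⟩ := hmi
        exact reachable_off_of_branch (hcon i hi) (hdisj i hi j hj hij) hk' (hk i hi) hlk'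
          (havoid _ hm) hx
    by_cases hl' : (restrictTo G (K j : Set V)ᶜ).Reachable (l j) (k i)
    · exact Or.inl fun x hx => hl'.trans (hout x hx).symm
    by_cases hm' : (restrictTo G (K j : Set V)ᶜ).Reachable (m j) (k i)
    · exact Or.inr (Or.inl fun x hx => hm'.trans (hout x hx).symm)
    refine Or.inr (Or.inr (Or.inr (Or.inr (Set.disjoint_left.2 ?_))))
    rintro x hx (hx' | hx')
    · exact hl' (SimpleGraph.Reachable.trans hx' (hout x hx))
    · exact hm' (SimpleGraph.Reachable.trans hx' (hout x hx))

/-- Finitely many vertices of a cluster lie in a finite connected set of vertices. -/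
theorem exists_finset_connected {G : SimpleGraph V} (a : V) (Z : Finset V)
    (hZ : ∀ z ∈ Z, G.Reachable a z) :
    ∃ K : Finset V, a ∈ K ∧ Z ⊆ K ∧ ∀ v ∈ K, (restrictTo G (K : Set V)).Reachable a v := by
  classical
  have hpath : ∀ z, G.Reachable a z → ∃ K : Finset V, a ∈ K ∧ z ∈ K ∧
      ∀ v ∈ K, (restrictTo G (K : Set V)).Reachable a v := by
    intro z hz
    refine reachable_induction (P := fun z => ∃ K : Finset V, a ∈ K ∧ z ∈ K ∧
      ∀ v ∈ K, (restrictTo G (K : Set V)).Reachable a v) hz ⟨{a}, by simp⟩ ?_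
    rintro x y - hxy ⟨K, haK, hxK, hK⟩
    have hmono : restrictTo G (K : Set V) ≤ restrictTo G ((insert y K : Finset V) : Set V) :=
      restrictTo_mono G (by simp)
    refine ⟨insert y K, by simp [haK], by simp, fun v hv => ?_⟩
    rcases Finset.mem_insert.1 hv with rfl | hv
    · exact ((hK x hxK).mono hmono).trans
        (SimpleGraph.Adj.reachable ⟨hxy, by simp [hxK], by simp⟩)
    · exact (hK v hv).mono hmono
  induction Z using Finset.induction_on with
  | empty => exact ⟨{a}, by simp⟩
  | insert z Z _ ih =>
    obtain ⟨K, haK, hZK, hK⟩ := ih fun z hz' => hZ z (Finset.mem_insert_of_mem hz')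
    obtain ⟨J, haJ, hzJ, hJ⟩ := hpath z (hZ z (Finset.mem_insert_self _ _))
    refine ⟨K ∪ J, by simp [haK], ?_, fun v hv => ?_⟩
    · intro x hx
      rcases Finset.mem_insert.1 hx with rfl | hx
      · exact Finset.mem_union_right _ hzJ
      · exact Finset.mem_union_left _ (hZK hx)
    · rcases Finset.mem_union.1 hv with hv | hv
      · exact (hK v hv).mono (restrictTo_mono G (by simp))
      · exact (hJ v hv).mono (restrictTo_mono G (by simp))

/-- If removing a finite set `K` leaves three infinite components of one cluster, then there is a
branching set. -/
theorem exists_branching {G : SimpleGraph V} (hfin : ∀ v, {w | G.Adj v w}.Finite)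
    (K : Finset V) (a : Fin 3 → V) (ha : ∀ i, G.Reachable (a 0) (a i))
    (hinf : ∀ i, {v | (restrictTo G (K : Set V)ᶜ).Reachable (a i) v}.Infinite)
    (hne : ∀ i j, i ≠ j → ¬ (restrictTo G (K : Set V)ᶜ).Reachable (a i) (a j)) :
    ∃ J : Finset V, Branching G J := by
  classical
  -- A branching set must be connected, so only the part of `K` in the cluster of `a 0` is enlarged.
  -- Within this cluster, removing `J` refines the components left by `K`.
  obtain ⟨J, haJ, hKJ, hJ⟩ := exists_finset_connected (a 0) (K.filter (G.Reachable (a 0)))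
    (fun z hz => (Finset.mem_filter.1 hz).2)
  have hrefine : ∀ x y, G.Reachable (a 0) x → (restrictTo G (J : Set V)ᶜ).Reachable x y →
      (restrictTo G (K : Set V)ᶜ).Reachable x y := by
    intro x y hx hxy
    refine reachable_induction (P := fun y => (restrictTo G (K : Set V)ᶜ).Reachable x y) hxy
      (SimpleGraph.Reachable.refl _) ?_
    intro y z hy hyz hr
    have hay : G.Reachable (a 0) y := hx.trans (hy.mono (restrictTo_le _ _))
    have haz : G.Reachable (a 0) z := hay.trans hyz.1.reachable
    refine hr.trans (SimpleGraph.Adj.reachable ⟨hyz.1, fun h => hyz.2.1 ?_, fun h => hyz.2.2 ?_⟩)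
    · exact hKJ (Finset.mem_filter.2 ⟨h, hay⟩)
    · exact hKJ (Finset.mem_filter.2 ⟨h, haz⟩)
  have hbranch : ∀ i, ∃ b, (b ∉ J ∧ (∃ k ∈ J, G.Adj b k) ∧
      {v | (restrictTo G (J : Set V)ᶜ).Reachable b v}.Infinite) ∧
      (restrictTo G (K : Set V)ᶜ).Reachable (a i) b := by
    intro i
    by_contra! hcon
    -- Outside `J`, an infinite component off `K` is covered by the components off `J` of these
    -- finitely many neighbours of `J`; hence one of them is infinite.
    let N : Set V := {b | b ∉ J ∧ (∃ k ∈ J, G.Adj b k) ∧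
      (restrictTo G (K : Set V)ᶜ).Reachable (a i) b}
    have hN : N.Finite := by
      refine (Set.Finite.biUnion J.finite_toSet fun k _ => hfin k).subset ?_
      rintro b ⟨-, ⟨k, hk, hbk⟩, -⟩
      exact Set.mem_biUnion hk hbk.symm
    refine hinf i (((hN.biUnion (t := fun b => {v | (restrictTo G (J : Set V)ᶜ).Reachable b v})
      ?_).union J.finite_toSet).subset ?_)
    · rintro b ⟨h1, h2, h3⟩
      by_contra hb
      exact hcon b ⟨h1, h2, hb⟩ h3
    · intro v hv
      by_cases hvJ : v ∈ J
      · exact Or.inr hvJ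
      · have hav : G.Reachable (a 0) v := (ha i).trans (SimpleGraph.Reachable.mono
          (restrictTo_le _ _) hv)
        obtain ⟨b, hb, hbk, hvb⟩ := exists_adj_of_reachable (K := (J : Set V)) hvJ haJ hav.symm
        refine Or.inl (Set.mem_biUnion (x := b) ⟨hb, hbk, ?_⟩ hvb.symm)
        exact SimpleGraph.Reachable.trans hv (hrefine v b hav hvb)
  choose b hb hab using hbranch
  refine ⟨J, fun u hu v hv => (hJ u hu).symm.trans (hJ v hv), b, hb, fun i j hij h => hne i j hij ?_⟩
  have : G.Reachable (a 0) (b i) := (ha i).trans ((hab i).mono (restrictTo_le _ _))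
  exact (hab i).trans ((hrefine _ _ this h).trans (hab j).symm)

end Graph

/-! ### Branching sets in translation-invariant random graphs -/

/-! ### Branching sets under graph isomorphisms -/

section Transport

variable {V W : Type*}

/-- The isomorphism of restricted graphs induced by a bijection that matches the edges. -/
def restrictToIso {G : SimpleGraph V} {G' : SimpleGraph W} (f : G ≃g G') {S : Set V} {T : Set W}
    (h : ∀ v, f v ∈ T ↔ v ∈ S) : restrictTo G S ≃g restrictTo G' T where
  toEquiv := f.toEquiv
  map_rel_iff' := by
    intro u v
    exact and_congr f.map_rel_iff' (and_congr (h u) (h v))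

theorem restrictToIso_reachable {G : SimpleGraph V} {G' : SimpleGraph W} (f : G ≃g G') {S : Set V}
    {T : Set W} (h : ∀ v, f v ∈ T ↔ v ∈ S) (u v : V) :
    (restrictTo G' T).Reachable (f u) (f v) ↔ (restrictTo G S).Reachable u v :=
  (restrictToIso f h).reachable_iff

theorem Branching.map {G : SimpleGraph V} {G' : SimpleGraph W} (f : G ≃g G') {K : Finset V}
    (hK : Branching G K) : Branching G' (K.map f.toEquiv.toEmbedding) := by
  obtain ⟨h1, a, h2, h3⟩ := hK
  have hS : ∀ v, f v ∈ ((K.map f.toEquiv.toEmbedding : Finset W) : Set W) ↔ v ∈ (K : Set V) := by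
    intro v
    simp
  have hS' : ∀ v, f v ∈ ((K.map f.toEquiv.toEmbedding : Finset W) : Set W)ᶜ ↔
      v ∈ (K : Set V)ᶜ := fun v => not_congr (hS v)
  refine ⟨?_, fun i => f (a i), fun i => ⟨?_, ?_, ?_⟩, fun i j hij => ?_⟩
  · intro u hu v hv
    obtain ⟨x, hx, rfl⟩ := Finset.mem_map.1 hu
    obtain ⟨y, hy, rfl⟩ := Finset.mem_map.1 hv
    exact (restrictToIso_reachable f hS x y).2 (h1 x hx y hy)
  · exact (hS' (a i)).2 (h2 i).1
  · obtain ⟨k, hk, hak⟩ := (h2 i).2.1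
    exact ⟨f k, (hS k).2 hk, f.map_rel_iff.2 hak⟩
  · refine ((h2 i).2.2.image f.injective.injOn).mono ?_
    rintro _ ⟨v, hv, rfl⟩
    exact (restrictToIso_reachable f hS' _ _).2 hv
  · rw [restrictToIso_reachable f hS']
    exact h3 i j hij

end Transport

/-! ### Measurability of connection and branching events -/

section Measurability

variable {Ω V : Type*} [MeasurableSpace Ω]

/-- `v` is at the end of a walk of length `n` that starts at `u`. -/
def ReachableIn (G : SimpleGraph V) (u : V) : ℕ → V → Prop
  | 0, v => u = v
  | n + 1, v => ∃ w, ReachableIn G u n w ∧ G.Adj w v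

/-- Grading by walk length writes connection through countable quantifiers over adjacencies, whence
its measurability. -/
theorem reachable_iff_exists_reachableIn (G : SimpleGraph V) (u v : V) :
    G.Reachable u v ↔ ∃ n, ReachableIn G u n v := by
  constructor
  · intro h
    refine reachable_induction (P := fun v => ∃ n, ReachableIn G u n v) h ⟨0, rfl⟩ ?_
    rintro x y - hxy ⟨n, hn⟩
    exact ⟨n + 1, x, hn, hxy⟩
  · rintro ⟨n, hn⟩
    induction n generalizing v with
    | zero => exact hn ▸ SimpleGraph.Reachable.refl _
    | succ n ih =>
      obtain ⟨w, hw, hwv⟩ := hn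
      exact (ih w hw).trans hwv.reachable

theorem measurable_reachable [Countable V] {X : Ω → SimpleGraph V}
    (hX : ∀ u v, Measurable fun ω => (X ω).Adj u v) (u v : V) :
    Measurable fun ω => (X ω).Reachable u v := by
  simp only [reachable_iff_exists_reachableIn]
  refine Measurable.exists fun n => ?_
  induction n generalizing v with
  | zero => exact measurable_const
  | succ n ih => exact Measurable.exists fun w => (ih w).and (hX w v)

theorem measurable_branching [Countable V] {X : Ω → SimpleGraph V}
    (hX : ∀ u v, Measurable fun ω => (X ω).Adj u v) (K : Finset V) :
    Measurable fun ω => Branching (X ω) K := by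
  have hr : ∀ (S : Set V) (u v : V), Measurable fun ω => (restrictTo (X ω) S).Reachable u v :=
    fun S u v => measurable_reachable
      (fun a b => (hX a b).and (measurable_const.and measurable_const)) u v
  -- This form quantifies over countable types only.
  have hinf : ∀ (P : V → Prop), {v | P v}.Infinite ↔ ∀ F : Finset V, ∃ v, v ∉ F ∧ P v := by
    intro P
    constructor
    · intro h F
      obtain ⟨v, hv, hF⟩ := h.exists_notMem_finset F
      exact ⟨v, hF, hv⟩
    · intro h hfin
      obtain ⟨v, hv, hP⟩ := h hfin.toFinset
      exact hv (hfin.mem_toFinset.2 hP)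
  simp only [Branching, hinf]
  refine Measurable.and ?_ (Measurable.exists fun a => Measurable.and ?_ ?_)
  · exact Measurable.forall fun u => Measurable.imp measurable_const <|
      Measurable.forall fun v => Measurable.imp measurable_const (hr _ u v)
  · refine Measurable.forall fun i => measurable_const.and (Measurable.and ?_ ?_)
    · exact Measurable.exists fun k => measurable_const.and (hX _ _)
    · exact Measurable.forall fun F => Measurable.exists fun v => measurable_const.and (hr _ _ _)
  · exact Measurable.forall fun i => Measurable.forall fun j => Measurable.imp measurable_const
      (hr _ _ _).not

end Measurability

/-! ### Boxes in the square lattice and the Burton–Keane theorem -/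

section Lattice

/-- The supremum norm on `ℤ²`. -/
def supNorm (v : ℤ × ℤ) : ℕ := max v.1.natAbs v.2.natAbs

theorem supNorm_le_iff (v : ℤ × ℤ) (n : ℕ) :
    supNorm v ≤ n ↔ (-(n : ℤ) ≤ v.1 ∧ v.1 ≤ n) ∧ (-(n : ℤ) ≤ v.2 ∧ v.2 ≤ n) := by
  simp only [supNorm, max_le_iff]
  omega

theorem finite_supNorm_le (n : ℕ) : {v : ℤ × ℤ | supNorm v ≤ n}.Finite := by
  refine (Finset.finite_toSet (Finset.Icc (-(n : ℤ)) n ×ˢ Finset.Icc (-(n : ℤ)) n)).subset ?_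
  intro v hv
  simpa [Prod.le_def, and_assoc, and_left_comm] using (supNorm_le_iff v n).1 hv

theorem supNorm_le_of_adj {u v : ℤ × ℤ} (h : squareLattice.Adj u v) :
    supNorm v ≤ supNorm u + 1 := by
  rw [squareLattice_adj] at h
  simp only [supNorm]
  omega

/-- The norm grows by at most one along an edge, so a component missing the sphere would stay in a
finite ball. -/
theorem exists_supNorm_eq {G : SimpleGraph (ℤ × ℤ)} (hG : G ≤ squareLattice) {a : ℤ × ℤ} {R : ℕ}
    (ha : supNorm a ≤ R) (hinf : {v | G.Reachable a v}.Infinite) :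
    ∃ y, supNorm y = R ∧ G.Reachable a y := by
  by_contra! hcon
  have hne : ∀ v, G.Reachable a v → supNorm v ≠ R := fun v hv h => hcon v h hv
  refine hinf ((finite_supNorm_le R).subset fun v hv => ?_)
  refine reachable_induction (P := fun v => supNorm v ≤ R) hv ha ?_
  intro x y hx hxy hxR
  have h1 := hne x hx
  have h2 := supNorm_le_of_adj (hG hxy)
  omega

/-- The sphere of radius `R` in the supremum norm. -/
noncomputable def sphere (R : ℕ) : Finset (ℤ × ℤ) :=
  ({-(R : ℤ), (R : ℤ)} ×ˢ Finset.Icc (-(R : ℤ)) R) ∪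
    (Finset.Icc (-(R : ℤ)) R ×ˢ {-(R : ℤ), (R : ℤ)})

theorem mem_sphere {R : ℕ} {v : ℤ × ℤ} (h : supNorm v = R) : v ∈ sphere R := by
  simp only [sphere, Finset.mem_union, Finset.mem_product, Finset.mem_insert,
    Finset.mem_singleton, Finset.mem_Icc]
  simp only [supNorm] at h
  omega

theorem card_sphere_le (R : ℕ) : (sphere R).card ≤ 4 * (2 * R + 1) := by
  have h1 : (Finset.Icc (-(R : ℤ)) R).card = 2 * R + 1 := by
    rw [Int.card_Icc]
    omega
  have h2 : ({-(R : ℤ), (R : ℤ)} : Finset ℤ).card ≤ 2 := Finset.card_le_two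
  refine (Finset.card_union_le _ _).trans ?_
  rw [Finset.card_product, Finset.card_product, h1]
  nlinarith

variable {Ω : Type*} [MeasurableSpace Ω]

/-- **Burton–Keane**: a translation-invariant random subgraph of the square lattice almost surely
has no branching sets. -/
theorem ae_not_branching (μ : Measure Ω) [IsProbabilityMeasure μ] (X : Ω → SimpleGraph (ℤ × ℤ))
    (hX : ∀ u v, Measurable fun ω => (X ω).Adj u v) (hle : ∀ ω, X ω ≤ squareLattice)
    (τ : ℤ × ℤ → Ω → Ω) (hτ : ∀ t, MeasurePreserving (τ t) μ μ)
    (hXτ : ∀ t ω u v, (X (τ t ω)).Adj u v ↔ (X ω).Adj (u - t) (v - t)) :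
    ∀ᵐ ω ∂μ, ∀ K, ¬ Branching (X ω) K := by
  classical
  rw [ae_all_iff]
  intro K
  let E : Set Ω := {ω | Branching (X ω) K}
  have hE : MeasurableSet E := measurableSet_setOfPred.2 (measurable_branching hX K)
  obtain ⟨n, hn⟩ : ∃ n, ∀ v ∈ K, supNorm v ≤ n :=
    ⟨K.sup supNorm, fun v hv => Finset.le_sup (f := supNorm) hv⟩
  -- The spacing `2 * n + 1` makes translates of a box of radius `n` disjoint.
  let t : ℕ × ℕ → ℤ × ℤ := fun i => ((2 * n + 1) * i.1, (2 * n + 1) * i.2)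
  have hcount : ∀ m : ℕ, ∀ ω, (((Finset.range m ×ˢ Finset.range m).filter
      (fun i => τ (t i) ω ∈ E)).card) ≤ 4 * (2 * (n + (2 * n + 1) * m + 1) + 1) := by
    intro m ω
    refine le_trans ?_ (card_sphere_le _)
    -- `K` branches in the configuration moved by `t i` exactly when `K - t i` branches in the
    -- original one. The sphere has radius one more than the bound on these sets, so that branches
    -- start inside it.
    let f : (ℕ × ℕ) → Finset (ℤ × ℤ) := fun i => K.map (Equiv.subRight (t i)).toEmbedding
    have hbound : ∀ i ∈ Finset.range m ×ˢ Finset.range m, ∀ v ∈ f i,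
        supNorm v ≤ n + (2 * n + 1) * m := by
      intro i hi v hv
      obtain ⟨w, hw, rfl⟩ := Finset.mem_map.1 hv
      have h1 := (supNorm_le_iff w n).1 (hn w hw)
      simp only [Finset.mem_product, Finset.mem_range] at hi
      have h2 : ((2 * n + 1) * i.1 : ℤ) ≤ (2 * n + 1) * m := by
        have := hi.1.le
        gcongr
      have h3 : ((2 * n + 1) * i.2 : ℤ) ≤ (2 * n + 1) * m := by
        have := hi.2.le
        gcongr
      have h4 : (0 : ℤ) ≤ (2 * n + 1) * i.1 := by positivity
      have h5 : (0 : ℤ) ≤ (2 * n + 1) * i.2 := by positivity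
      rw [supNorm_le_iff]
      simp only [t, Equiv.coe_toEmbedding, Equiv.subRight_apply, Prod.fst_sub, Prod.snd_sub]
      push_cast
      omega
    refine card_branching_le (G := X ω) _ f (sphere (n + (2 * n + 1) * m + 1)) ?_ ?_ ?_
    · intro i hi
      have hi' : Branching (X (τ (t i) ω)) K := (Finset.mem_filter.1 hi).2
      exact hi'.map (G' := X ω) ⟨Equiv.subRight (t i), fun {u v} => (hXτ (t i) ω u v).symm⟩
    · intro i _ j _ hij
      refine Set.disjoint_left.2 fun v hvi hvj => hij ?_
      obtain ⟨u, hu, rfl⟩ := Finset.mem_map.1 hvi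
      obtain ⟨w, hw, hwu⟩ := Finset.mem_map.1 hvj
      have h1 := (supNorm_le_iff u n).1 (hn u hu)
      have h2 := (supNorm_le_iff w n).1 (hn w hw)
      simp only [t, Equiv.coe_toEmbedding, Equiv.subRight_apply, Prod.ext_iff, Prod.fst_sub,
        Prod.snd_sub] at hwu
      have key : ∀ a b : ℕ, ∀ x y : ℤ, -n ≤ x → x ≤ n → -n ≤ y → y ≤ n →
          y - (2 * n + 1) * b = x - (2 * n + 1) * a → a = b := by
        intro a b x y _ _ _ _ h
        rcases lt_trichotomy a b with hab | hab | hab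
        · have : (a : ℤ) + 1 ≤ b := by exact_mod_cast hab
          nlinarith
        · exact hab
        · have : (b : ℤ) + 1 ≤ a := by exact_mod_cast hab
          nlinarith
      exact Prod.ext (key _ _ u.1 w.1 h1.1.1 h1.1.2 h2.1.1 h2.1.2 hwu.1)
        (key _ _ u.2 w.2 h1.2.1 h1.2.2 h2.2.1 h2.2.2 hwu.2)
    · rintro i hi a ⟨k, hk, hak⟩ hinf
      have h1 := hbound i (Finset.mem_filter.1 hi).1 k hk
      have h2 := supNorm_le_of_adj (hle ω hak.symm)
      obtain ⟨y, hy, hay⟩ := exists_supNorm_eq (R := n + (2 * n + 1) * m + 1)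
        ((restrictTo_le _ _).trans (hle ω)) (by omega) hinf
      exact ⟨y, mem_sphere hy, hay⟩
  have hmeas : ∀ m : ℕ, (m : ENNReal) * m * μ E ≤
      ((4 * (2 * (n + (2 * n + 1) * m + 1) + 1) : ℕ) : ENNReal) := by
    intro m
    calc (m : ENNReal) * m * μ E
        = ∑ i ∈ Finset.range m ×ˢ Finset.range m, μ (τ (t i) ⁻¹' E) := by
          simp [(hτ _).measure_preimage hE.nullMeasurableSet]
      _ = ∑ i ∈ Finset.range m ×ˢ Finset.range m, ∫⁻ ω, (τ (t i) ⁻¹' E).indicator 1 ω ∂μ := by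
          refine Finset.sum_congr rfl fun i _ => ?_
          rw [lintegral_indicator_one ((hτ (t i)).measurable hE)]
      _ = ∫⁻ ω, ∑ i ∈ Finset.range m ×ˢ Finset.range m, (τ (t i) ⁻¹' E).indicator 1 ω ∂μ := by
          rw [lintegral_finsetSum]
          exact fun i _ => measurable_one.indicator ((hτ (t i)).measurable hE)
      _ ≤ ∫⁻ _, ((4 * (2 * (n + (2 * n + 1) * m + 1) + 1) : ℕ) : ENNReal) ∂μ := by
          refine lintegral_mono fun ω => ?_
          refine le_trans (le_of_eq ?_) (Nat.cast_le.2 (hcount m ω))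
          rw [Finset.card_filter, Nat.cast_sum]
          refine Finset.sum_congr rfl fun i _ => ?_
          by_cases h : τ (t i) ω ∈ E <;> simp [Set.indicator, h]
      _ = _ := by simp
  have hreal : ∀ m : ℕ, (m : ℝ) * m * μ.real E ≤
      ((4 * (2 * (n + (2 * n + 1) * m + 1) + 1) : ℕ) : ℝ) := by
    intro m
    have := ENNReal.toReal_mono (ENNReal.natCast_ne_top _) (hmeas m)
    simpa only [measureReal_def, ENNReal.toReal_mul, ENNReal.toReal_natCast] using this
  have hzero : μ E = 0 := by
    by_contra hpos
    have hp : 0 < μ.real E := ENNReal.toReal_pos hpos (measure_ne_top _ _)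
    -- The perimeter bound equals `(16 * n + 8) * m + (8 * n + 12)`, at most `(24 * n + 20) * m`
    -- once `m ≥ 1`.
    obtain ⟨m, hm⟩ := exists_nat_gt (((24 * n + 20 : ℕ) : ℝ) / μ.real E)
    rw [div_lt_iff₀ hp] at hm
    have hm1 : 1 ≤ m := by
      rcases Nat.eq_zero_or_pos m with rfl | h
      · simp only [Nat.cast_zero, zero_mul] at hm
        exact absurd hm (not_lt.2 (Nat.cast_nonneg _))
      · exact h
    have h1 := hreal m
    have h2 : 4 * (2 * (n + (2 * n + 1) * m + 1) + 1) ≤ m * (24 * n + 20) := by nlinarith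
    have h3 : ((4 * (2 * (n + (2 * n + 1) * m + 1) + 1) : ℕ) : ℝ) ≤ m * ((24 * n + 20 : ℕ) : ℝ) := by
      exact_mod_cast h2
    have hm0 : (0 : ℝ) < m := by exact_mod_cast hm1
    nlinarith
  rw [ae_iff]
  simpa [E] using hzero

end Lattice

/-! ### Chains modulo two on the square lattice

A chain is a pair `h v : ℤ × ℤ → ZMod 2`, where `h p` is the coefficient of the edge from `p` to
`p + (1, 0)` and `v p` that of the edge from `p` to `p + (0, 1)`. -/

section Chains

/-- The boundary of a chain at the vertex `p`. -/
def boundary (h v : ℤ × ℤ → ZMod 2) (p : ℤ × ℤ) : ZMod 2 :=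
  h p + h (p - (1, 0)) + v p + v (p - (0, 1))

/-- The chain `(h, v)` is supported on the edges of `G`. -/
def SupportedOn (h v : ℤ × ℤ → ZMod 2) (G : SimpleGraph (ℤ × ℤ)) : Prop :=
  (∀ p, h p ≠ 0 → G.Adj p (p + (1, 0))) ∧ ∀ p, v p ≠ 0 → G.Adj p (p + (0, 1))

/-- The coefficient of a chain on the edge that separates the plaquettes `q` and `p`, if `p` is the
right or the upper neighbour of `q`. -/
def cross (h v : ℤ × ℤ → ZMod 2) (q p : ℤ × ℤ) : ZMod 2 :=
  if p = q + (1, 0) then v p else if p = q + (0, 1) then h p else 0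

/-- The chain of the edges at whose ends `s` differs, as a function of pairs of plaquettes. -/
def cut (s : ℤ × ℤ → ZMod 2) : ℤ × ℤ → ℤ × ℤ → ZMod 2 :=
  cross (fun p => s p + s (p + (1, 0))) (fun p => s p + s (p + (0, 1)))

theorem cross_right (h v : ℤ × ℤ → ZMod 2) (q : ℤ × ℤ) :
    cross h v q (q + (1, 0)) = v (q + (1, 0)) := by simp [cross]

theorem cross_up (h v : ℤ × ℤ → ZMod 2) (q : ℤ × ℤ) :
    cross h v q (q + (0, 1)) = h (q + (0, 1)) := by simp [cross]

theorem cross_eq_zero (h v : ℤ × ℤ → ZMod 2) {q p : ℤ × ℤ} (h1 : p ≠ q + (1, 0))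
    (h2 : p ≠ q + (0, 1)) : cross h v q p = 0 := by simp [cross, h1, h2]

theorem cross_add (h v h' v' : ℤ × ℤ → ZMod 2) (q p : ℤ × ℤ) :
    cross (h + h') (v + v') q p = cross h v q p + cross h' v' q p := by
  unfold cross
  split_ifs <;> simp

theorem cut_add (s s' : ℤ × ℤ → ZMod 2) (q p : ℤ × ℤ) :
    cut (s + s') q p = cut s q p + cut s' q p := by
  unfold cut
  rw [← cross_add]
  congr 1 <;> · ext p; simp only [Pi.add_apply]; ring

theorem boundary_add (h v h' v' : ℤ × ℤ → ZMod 2) :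
    boundary (h + h') (v + v') = boundary h v + boundary h' v' := by
  ext p
  simp only [boundary, Pi.add_apply]
  ring

theorem SupportedOn.add {h v h' v' : ℤ × ℤ → ZMod 2} {G : SimpleGraph (ℤ × ℤ)}
    (H : SupportedOn h v G) (H' : SupportedOn h' v' G) : SupportedOn (h + h') (v + v') G := by
  have key : ∀ a b : ZMod 2, a + b ≠ 0 → a ≠ 0 ∨ b ≠ 0 := by decide
  exact ⟨fun p hp => (key _ _ hp).elim (H.1 p) (H'.1 p),
    fun p hp => (key _ _ hp).elim (H.2 p) (H'.2 p)⟩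

theorem squareLattice_adj_iff (p q : ℤ × ℤ) : squareLattice.Adj p q ↔
    q = p + (1, 0) ∨ q = p + (0, 1) ∨ p = q + (1, 0) ∨ p = q + (0, 1) := by
  rw [squareLattice_adj]
  simp only [Prod.ext_iff, Prod.fst_add, Prod.snd_add]
  omega

/-- The chain of a single edge. Its support, its boundary and its pairing with a cut. -/
theorem exists_chain_of_adj {a b : ℤ × ℤ} (hab : squareLattice.Adj a b) :
    ∃ h v : ℤ × ℤ → ZMod 2, (∀ G : SimpleGraph (ℤ × ℤ), G.Adj a b → SupportedOn h v G) ∧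
      boundary h v = Pi.single a 1 + Pi.single b 1 ∧
      ∃ F : Finset (ℤ × ℤ), (∀ q p, cross h v q p ≠ 0 → q ∈ F ∧ p ∈ F) ∧
        ∀ K, F ⊆ K → ∀ s, ∑ q ∈ K, ∑ p ∈ K, cross h v q p * cut s q p = s a + s b := by
  have hright : ∀ a : ℤ × ℤ, ∃ h v : ℤ × ℤ → ZMod 2,
      (∀ G : SimpleGraph (ℤ × ℤ), G.Adj a (a + (1, 0)) → SupportedOn h v G) ∧
      boundary h v = Pi.single a 1 + Pi.single (a + (1, 0)) 1 ∧
      ∃ F : Finset (ℤ × ℤ), (∀ q p, cross h v q p ≠ 0 → q ∈ F ∧ p ∈ F) ∧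
        ∀ K, F ⊆ K → ∀ s, ∑ q ∈ K, ∑ p ∈ K, cross h v q p * cut s q p
          = s a + s (a + (1, 0)) := by
    intro a
    -- The horizontal edge at `a` separates the plaquette `a` from the one below it.
    have hne : ∀ q p, cross (Pi.single a 1) 0 q p ≠ 0 → q = a - (0, 1) ∧ p = a := by
      intro q p hqp
      unfold cross at hqp
      split_ifs at hqp with h1 h2
      · simp at hqp
      · have : p = a := by
          by_contra hpa
          exact hqp (Pi.single_eq_of_ne hpa _)
        exact ⟨by rw [← this, h2]; simp, this⟩
      · exact absurd rfl hqp
    refine ⟨Pi.single a 1, 0, fun G hG => ⟨fun p hp => ?_, fun p hp => absurd rfl hp⟩, ?_,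
      {a - (0, 1), a}, fun q p hqp => ?_, fun K hK s => ?_⟩
    · by_cases hpa : p = a
      · exact hpa ▸ hG
      · exact absurd (Pi.single_eq_of_ne hpa _) hp
    · ext p
      simp [boundary, Pi.single_apply, sub_eq_iff_eq_add]
    · obtain ⟨rfl, rfl⟩ := hne q p hqp
      simp
    · have ha : a - (0, 1) ∈ K := hK (by simp)
      have ha' : a ∈ K := hK (by simp)
      have hup : a = a - (0, 1) + (0, 1) := by simp
      rw [Finset.sum_eq_single_of_mem _ ha, Finset.sum_eq_single_of_mem _ ha']
      · have h1 : cross (Pi.single a 1) 0 (a - (0, 1)) a = 1 := by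
          conv_lhs => rw [show cross (Pi.single a 1) 0 (a - (0, 1)) a =
            cross (Pi.single a 1) 0 (a - (0, 1)) (a - (0, 1) + (0, 1)) by rw [← hup]]
          rw [cross_up, ← hup, Pi.single_eq_same]
        have h2 : cut s (a - (0, 1)) a = s a + s (a + (1, 0)) := by
          conv_lhs => rw [show cut s (a - (0, 1)) a =
            cut s (a - (0, 1)) (a - (0, 1) + (0, 1)) by rw [← hup]]
          unfold cut
          rw [cross_up, ← hup]
        rw [h1, h2, one_mul]
      · intro p _ hp
        by_contra hne0
        exact hp (hne _ _ (left_ne_zero_of_mul hne0)).2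
      · intro q _ hq
        refine Finset.sum_eq_zero fun p _ => ?_
        by_contra hne0
        exact hq (hne _ _ (left_ne_zero_of_mul hne0)).1
  have hup : ∀ a : ℤ × ℤ, ∃ h v : ℤ × ℤ → ZMod 2,
      (∀ G : SimpleGraph (ℤ × ℤ), G.Adj a (a + (0, 1)) → SupportedOn h v G) ∧
      boundary h v = Pi.single a 1 + Pi.single (a + (0, 1)) 1 ∧
      ∃ F : Finset (ℤ × ℤ), (∀ q p, cross h v q p ≠ 0 → q ∈ F ∧ p ∈ F) ∧
        ∀ K, F ⊆ K → ∀ s, ∑ q ∈ K, ∑ p ∈ K, cross h v q p * cut s q p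
          = s a + s (a + (0, 1)) := by
    intro a
    have hne : ∀ q p, cross 0 (Pi.single a 1) q p ≠ 0 → q = a - (1, 0) ∧ p = a := by
      intro q p hqp
      unfold cross at hqp
      split_ifs at hqp with h1 h2
      · have : p = a := by
          by_contra hpa
          exact hqp (Pi.single_eq_of_ne hpa _)
        exact ⟨by rw [← this, h1]; simp, this⟩
      · simp at hqp
      · exact absurd rfl hqp
    refine ⟨0, Pi.single a 1, fun G hG => ⟨fun p hp => absurd rfl hp, fun p hp => ?_⟩, ?_,
      {a - (1, 0), a}, fun q p hqp => ?_, fun K hK s => ?_⟩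
    · by_cases hpa : p = a
      · exact hpa ▸ hG
      · exact absurd (Pi.single_eq_of_ne hpa _) hp
    · ext p
      simp [boundary, Pi.single_apply, sub_eq_iff_eq_add]
    · obtain ⟨rfl, rfl⟩ := hne q p hqp
      simp
    · have ha : a - (1, 0) ∈ K := hK (by simp)
      have ha' : a ∈ K := hK (by simp)
      have hup : a = a - (1, 0) + (1, 0) := by simp
      rw [Finset.sum_eq_single_of_mem _ ha, Finset.sum_eq_single_of_mem _ ha']
      · have h1 : cross 0 (Pi.single a 1) (a - (1, 0)) a = 1 := by
          conv_lhs => rw [show cross 0 (Pi.single a 1) (a - (1, 0)) a =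
            cross 0 (Pi.single a 1) (a - (1, 0)) (a - (1, 0) + (1, 0)) by rw [← hup]]
          rw [cross_right, ← hup, Pi.single_eq_same]
        have h2 : cut s (a - (1, 0)) a = s a + s (a + (0, 1)) := by
          conv_lhs => rw [show cut s (a - (1, 0)) a =
            cut s (a - (1, 0)) (a - (1, 0) + (1, 0)) by rw [← hup]]
          unfold cut
          rw [cross_right, ← hup]
        rw [h1, h2, one_mul]
      · intro p _ hp
        by_contra hne0
        exact hp (hne _ _ (left_ne_zero_of_mul hne0)).2
      · intro q _ hq
        refine Finset.sum_eq_zero fun p _ => ?_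
        by_contra hne0
        exact hq (hne _ _ (left_ne_zero_of_mul hne0)).1
  rcases (squareLattice_adj_iff a b).1 hab with rfl | rfl | rfl | rfl
  · exact hright a
  · exact hup a
  · obtain ⟨h, v, h1, h2, F, h3, h4⟩ := hright b
    exact ⟨h, v, fun G hG => h1 G hG.symm, h2.trans (add_comm _ _), F, h3,
      fun K hK s => (h4 K hK s).trans (add_comm _ _)⟩
  · obtain ⟨h, v, h1, h2, F, h3, h4⟩ := hup b
    exact ⟨h, v, fun G hG => h1 G hG.symm, h2.trans (add_comm _ _), F, h3,
      fun K hK s => (h4 K hK s).trans (add_comm _ _)⟩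

/-- Add the chains of the edges of a path: boundary and pairing with a cut telescope modulo two. The
finite set `F` holds the plaquettes beside the path, so any larger `K` sees every crossing. -/
theorem exists_chain_of_reachable {G : SimpleGraph (ℤ × ℤ)} (hG : G ≤ squareLattice)
    {a b : ℤ × ℤ} (hab : G.Reachable a b) :
    ∃ h v : ℤ × ℤ → ZMod 2, SupportedOn h v G ∧
      boundary h v = Pi.single a 1 + Pi.single b 1 ∧
      ∃ F : Finset (ℤ × ℤ), (∀ q p, cross h v q p ≠ 0 → q ∈ F ∧ p ∈ F) ∧
        ∀ K, F ⊆ K → ∀ s, ∑ q ∈ K, ∑ p ∈ K, cross h v q p * cut s q p = s a + s b := by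
  classical
  have htwo : ∀ x : ZMod 2, x + x = 0 := by decide
  refine reachable_induction (P := fun b => ∃ h v : ℤ × ℤ → ZMod 2, SupportedOn h v G ∧
      boundary h v = Pi.single a 1 + Pi.single b 1 ∧
      ∃ F : Finset (ℤ × ℤ), (∀ q p, cross h v q p ≠ 0 → q ∈ F ∧ p ∈ F) ∧
        ∀ K, F ⊆ K → ∀ s, ∑ q ∈ K, ∑ p ∈ K, cross h v q p * cut s q p = s a + s b) hab ?_ ?_
  · refine ⟨0, 0, ⟨fun p hp => absurd rfl hp, fun p hp => absurd rfl hp⟩, ?_, ∅, ?_, ?_⟩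
    · ext p
      simp [boundary, htwo]
    · intro q p h
      exact absurd (by simp [cross]) h
    · intro K _ s
      simp [cross, htwo]
  · rintro x y - hxy ⟨h, v, h1, h2, F, h3, h4⟩
    obtain ⟨h', v', h1', h2', F', h3', h4'⟩ := exists_chain_of_adj (hG hxy)
    refine ⟨h + h', v + v', h1.add (h1' G hxy), ?_, F ∪ F', ?_, ?_⟩
    · rw [boundary_add, h2, h2']
      ext p
      simp only [Pi.add_apply]
      linear_combination htwo ((Pi.single x 1 : ℤ × ℤ → ZMod 2) p)
    · intro q p hqp
      rw [cross_add] at hqp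
      have key : ∀ a b : ZMod 2, a + b ≠ 0 → a ≠ 0 ∨ b ≠ 0 := by decide
      rcases key _ _ hqp with hqp | hqp
      · exact ⟨Finset.mem_union_left _ (h3 q p hqp).1, Finset.mem_union_left _ (h3 q p hqp).2⟩
      · exact ⟨Finset.mem_union_right _ (h3' q p hqp).1, Finset.mem_union_right _ (h3' q p hqp).2⟩
    · intro K hK s
      have e1 := h4 K (Finset.union_subset_left hK) s
      have e2 := h4' K (Finset.union_subset_right hK) s
      simp only [cross_add, add_mul, Finset.sum_add_distrib, e1, e2]
      linear_combination htwo (s x)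

/-- An infinite cluster contains a chain, possibly infinite, with boundary one point. -/
theorem exists_chain_to_infinity {G : SimpleGraph (ℤ × ℤ)} (hG : G ≤ squareLattice)
    {a : ℤ × ℤ} (ha : {v | G.Reachable a v}.Infinite) :
    ∃ h v : ℤ × ℤ → ZMod 2, SupportedOn h v G ∧ boundary h v = Pi.single a 1 := by
  have hfar : ∀ n : ℕ, ∃ b, n < supNorm b ∧ G.Reachable a b := by
    intro n
    by_contra! hcon
    exact ha ((finite_supNorm_le n).subset fun v hv => not_lt.1 fun h => hcon v h hv)
  choose b hb hab using hfar
  choose h v hs hbd _ using fun n => exists_chain_of_reachable hG (hab n)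
  -- Compactness: take the limit, coefficient by coefficient, of paths to ever more distant points
  -- `b n`. At a fixed vertex the far end eventually contributes nothing to the boundary.
  let U : Ultrafilter ℕ := Filter.hyperfilter ℕ
  have hlim : ∀ f : ℕ → ZMod 2, ∃ c, ∀ᶠ n in (U : Filter ℕ), f n = c := by
    intro f
    by_cases h0 : ∀ᶠ n in (U : Filter ℕ), f n = 0
    · exact ⟨0, h0⟩
    · refine ⟨1, (Ultrafilter.eventually_not.2 h0).mono fun n hn => ?_⟩
      revert hn
      generalize f n = x
      revert x
      decide
  choose lh hlh using fun p => hlim fun n => h n p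
  choose lv hlv using fun p => hlim fun n => v n p
  refine ⟨lh, lv, ⟨fun p hp => ?_, fun p hp => ?_⟩, ?_⟩
  · obtain ⟨n, hn⟩ := (hlh p).exists
    exact (hs n).1 p (hn ▸ hp)
  · obtain ⟨n, hn⟩ := (hlv p).exists
    exact (hs n).2 p (hn ▸ hp)
  · ext p
    have hlarge : ∀ᶠ n in (U : Filter ℕ), supNorm p ≤ n := by
      have : ∀ᶠ n in (Filter.cofinite : Filter ℕ), supNorm p ≤ n := by
        rw [Nat.cofinite_eq_atTop]
        exact Filter.eventually_ge_atTop _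
      exact this.filter_mono Filter.hyperfilter_le_cofinite
    obtain ⟨n, ⟨⟨⟨⟨h1, h2⟩, h3⟩, h4⟩, h5⟩⟩ := ((((hlh p).and (hlh (p - (1, 0)))).and
      (hlv p)).and (hlv (p - (0, 1)))).and hlarge |>.exists
    have hne : p ≠ b n := by
      rintro rfl
      exact absurd (hb n) (not_lt.2 h5)
    have := congrFun (hbd n) p
    simp only [boundary, h1, h2, h3, h4, Pi.add_apply, Pi.single_eq_of_ne hne, add_zero] at this
    exact this

/-- Sum `f` from `0` up to `n`, or from `n` up to `0`; signs are irrelevant modulo two. -/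
theorem exists_primitive (f : ℤ → ZMod 2) : ∃ F : ℤ → ZMod 2, ∀ n, F n + F (n + 1) = f n := by
  have htwo : ∀ x : ZMod 2, x + x = 0 := by decide
  refine ⟨fun n => ∑ i ∈ Finset.Ico 0 n, f i + ∑ i ∈ Finset.Ico n 0, f i, fun n => ?_⟩
  rcases le_or_gt 0 n with hn | hn
  · have h1 : Finset.Ico 0 (n + 1) = insert n (Finset.Ico 0 n) := by
      ext x; simp only [Finset.mem_insert, Finset.mem_Ico]; omega
    have h2 : Finset.Ico n 0 = ∅ := Finset.Ico_eq_empty (by omega)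
    have h3 : Finset.Ico (n + 1) 0 = ∅ := Finset.Ico_eq_empty (by omega)
    simp only [h1, h2, h3, Finset.sum_empty, add_zero]
    rw [Finset.sum_insert (by simp)]
    linear_combination htwo (∑ i ∈ Finset.Ico 0 n, f i)
  · have h1 : Finset.Ico n 0 = insert n (Finset.Ico (n + 1) 0) := by
      ext x; simp only [Finset.mem_insert, Finset.mem_Ico]; omega
    have h2 : Finset.Ico 0 n = ∅ := Finset.Ico_eq_empty (by omega)
    have h3 : Finset.Ico 0 (n + 1) = ∅ := Finset.Ico_eq_empty (by omega)
    simp only [h1, h2, h3, Finset.sum_empty, zero_add]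
    rw [Finset.sum_insert (by simp)]
    linear_combination htwo (∑ i ∈ Finset.Ico (n + 1) 0, f i)

/-- A cycle, possibly infinite, is the boundary of a set of plaquettes. -/
theorem exists_potential {h v : ℤ × ℤ → ZMod 2} (hb : boundary h v = 0) :
    ∃ σ : ℤ × ℤ → ZMod 2, (∀ q, σ q + σ (q + (1, 0)) = v (q + (1, 0))) ∧
      ∀ q, σ q + σ (q + (0, 1)) = h (q + (0, 1)) := by
  have htwo : ∀ x : ZMod 2, x + x = 0 := by decide
  -- Integrate `v` along the row `y = 0` and `h` up every column. Vanishing of the boundary then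
  -- propagates the horizontal equation from the row `y = 0` to all rows (`hvert`).
  obtain ⟨A, hA⟩ := exists_primitive fun x => v (x + 1, 0)
  choose B hB using fun x => exists_primitive fun y => h (x, y + 1)
  have hbd : ∀ x y, h (x + 1, y + 1) + h (x, y + 1) + v (x + 1, y + 1) + v (x + 1, y) = 0 := by
    intro x y
    have := congrFun hb (x + 1, y + 1)
    simpa [boundary] using this
  let C : ℤ → ℤ → ZMod 2 := fun x y => B x y + B x 0
  have hC : ∀ x y, C x y + C x (y + 1) = h (x, y + 1) := fun x y => by
    linear_combination hB x y + htwo (B x 0)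
  have hC0 : ∀ x, C x 0 = 0 := fun x => htwo _
  have hvert : ∀ x y, C x y + C (x + 1) y = v (x + 1, y) + v (x + 1, 0) := by
    intro x y
    induction y using Int.induction_on with
    | zero => linear_combination hC0 x + hC0 (x + 1) - htwo (v (x + 1, 0))
    | succ y ih =>
      linear_combination hC x y + hC (x + 1) y - ih + hbd x y - htwo (v (x + 1, y + 1))
        - htwo (v (x + 1, y)) - htwo (v (x + 1, 0))
    | pred y ih =>
      have e1 := hC x (-y - 1)
      have e2 := hC (x + 1) (-y - 1)
      have e3 := hbd x (-y - 1)
      rw [sub_add_cancel] at e1 e2 e3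
      linear_combination e1 + e2 - ih + e3 - htwo (v (x + 1, -y)) - htwo (v (x + 1, -y - 1))
        - htwo (v (x + 1, 0))
  refine ⟨fun q => A q.1 + C q.1 q.2, fun q => ?_, fun q => ?_⟩
  · obtain ⟨x, y⟩ := q
    simp only [Prod.mk_add_mk, add_zero]
    linear_combination hA x + hvert x y + htwo (v (x + 1, 0))
  · obtain ⟨x, y⟩ := q
    simp only [Prod.mk_add_mk, add_zero]
    linear_combination hC x y + htwo (A x)

end Chains

/-! ### Planar duality: cuts, parities and dual components -/

section Planar

/-- `H`, as a graph of plaquettes, consists of the duals of the edges that are not in `G`. -/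
structure IsPlanarDual (G H : SimpleGraph (ℤ × ℤ)) : Prop where
  le : G ≤ squareLattice
  dual_le : H ≤ squareLattice
  right : ∀ q, G.Adj (q + (1, 0)) (q + (1, 0) + (0, 1)) ↔ ¬ H.Adj q (q + (1, 0))
  up : ∀ q, G.Adj (q + (0, 1)) (q + (0, 1) + (1, 0)) ↔ ¬ H.Adj q (q + (0, 1))

/-- The symmetrized form of `cut`. -/
def symmCut (s : ℤ × ℤ → ZMod 2) (q p : ℤ × ℤ) : ZMod 2 := cut s q p + cut s p q

theorem symmCut_comm (s : ℤ × ℤ → ZMod 2) (q p : ℤ × ℤ) : symmCut s q p = symmCut s p q :=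
  add_comm _ _

theorem symmCut_add (s s' : ℤ × ℤ → ZMod 2) (q p : ℤ × ℤ) :
    symmCut (s + s') q p = symmCut s q p + symmCut s' q p := by
  simp only [symmCut, cut_add]
  ring

theorem zmod_two_add_self (x : ZMod 2) : x + x = 0 := CharTwo.add_self_eq_zero x

/-- The four neighbours of a plaquette. -/
def neighbours (q : ℤ × ℤ) : Finset (ℤ × ℤ) :=
  {q + (1, 0), q + (0, 1), q - (1, 0), q - (0, 1)}

/-- A cut has an even number of edges around each plaquette. -/
theorem sum_symmCut (s : ℤ × ℤ → ZMod 2) {q : ℤ × ℤ} {L : Finset (ℤ × ℤ)}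
    (hL : neighbours q ⊆ L) : ∑ p ∈ L, symmCut s q p = 0 := by
  have h1 : q + (1, 0) ∈ L := hL (by simp [neighbours])
  have h2 : q + (0, 1) ∈ L := hL (by simp [neighbours])
  have h3 : q - (1, 0) ∈ L := hL (by simp [neighbours])
  have h4 : q - (0, 1) ∈ L := hL (by simp [neighbours])
  have hcut : ∀ a b, cut s a b = (if b = a + (1, 0) then s b + s (b + (0, 1)) else 0) +
      (if b = a + (0, 1) then s b + s (b + (1, 0)) else 0) := by
    intro a b
    unfold cut cross
    by_cases hb : b = a + (1, 0)
    · subst hb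
      simp
    · simp [hb]
  have hflip : ∀ a b e : ℤ × ℤ, (b = a + e) = (a = b - e) := fun a b e => by
    rw [eq_sub_iff_add_eq, eq_comm (a := b)]
  -- Going around the plaquette, each corner value of `s` appears twice.
  have e1 : ∑ p ∈ L, cut s q p = s (q + (1, 0)) + s (q + (1, 0) + (0, 1)) +
      (s (q + (0, 1)) + s (q + (0, 1) + (1, 0))) := by
    simp only [hcut, Finset.sum_add_distrib, Finset.sum_ite_eq', h1, h2, if_true]
  have e2 : ∑ p ∈ L, cut s p q = s q + s (q + (0, 1)) + (s q + s (q + (1, 0))) := by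
    simp only [hcut, hflip _ q, Finset.sum_add_distrib, Finset.sum_ite_eq', h3, h4, if_true]
  simp only [symmCut, Finset.sum_add_distrib, e1, e2]
  rw [show q + (0, 1) + (1, 0) = q + (1, 0) + (0, 1) by abel]
  linear_combination zmod_two_add_self (s (q + (1, 0))) + zmod_two_add_self (s (q + (0, 1))) +
    zmod_two_add_self (s q) + zmod_two_add_self (s (q + (1, 0) + (0, 1)))

/-- Summation by parts: it trades `σ` for its jump `σ q + σ p` across an edge. -/
theorem sum_sum_symmetrized (K : Finset (ℤ × ℤ)) (σ : ℤ × ℤ → ZMod 2)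
    (f : ℤ × ℤ → ℤ × ℤ → ZMod 2) :
    ∑ q ∈ K, ∑ p ∈ K, σ q * (f q p + f p q) = ∑ q ∈ K, ∑ p ∈ K, (σ q + σ p) * f q p := by
  simp only [mul_add, add_mul, Finset.sum_add_distrib]
  congr 1
  exact Finset.sum_comm

variable {G H : SimpleGraph (ℤ × ℤ)}

/-- A union of clusters is bounded by closed edges only, and their duals are open. -/
theorem IsPlanarDual.adj_of_symmCut_ne_zero (hGH : IsPlanarDual G H) {s : ℤ × ℤ → ZMod 2}
    (hs : ∀ u v, G.Adj u v → s u = s v) {q p : ℤ × ℤ} (h : symmCut s q p ≠ 0) : H.Adj q p := by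
  have key : ∀ q p, cut s q p ≠ 0 → H.Adj q p := by
    intro q p h
    unfold cut cross at h
    split_ifs at h with h1 h2
    · subst h1
      by_contra hH
      beta_reduce at h
      rw [hs _ _ ((hGH.right q).2 hH)] at h
      exact h (zmod_two_add_self _)
    · subst h2
      by_contra hH
      beta_reduce at h
      rw [hs _ _ ((hGH.up q).2 hH)] at h
      exact h (zmod_two_add_self _)
    · exact absurd rfl h
  by_cases h1 : cut s q p = 0
  · refine (key p q fun h2 => h ?_).symm
    simp [symmCut, h1, h2]
  · exact key q p h1

/-- The parity of the number of cut edges between `K` and the part of the set `D` in `L`. -/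
noncomputable def cutParity (K L : Finset (ℤ × ℤ)) (D : Set (ℤ × ℤ)) [DecidablePred (· ∈ D)]
    (s : ℤ × ℤ → ZMod 2) : ZMod 2 :=
  ∑ p ∈ (L \ K).filter (· ∈ D), ∑ q ∈ K, symmCut s q p

theorem cutParity_add (K L : Finset (ℤ × ℤ)) (D : Set (ℤ × ℤ)) [DecidablePred (· ∈ D)]
    (s s' : ℤ × ℤ → ZMod 2) :
    cutParity K L D (s + s') = cutParity K L D s + cutParity K L D s' := by
  simp only [cutParity, symmCut_add, Finset.sum_add_distrib]

theorem symmCut_eq_zero_of_notMem {s : ℤ × ℤ → ZMod 2} {q p : ℤ × ℤ} (h : p ∉ neighbours q) :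
    symmCut s q p = 0 := by
  simp only [neighbours, Finset.mem_insert, Finset.mem_singleton, not_or] at h
  obtain ⟨h1, h2, h3, h4⟩ := h
  unfold symmCut cut
  rw [cross_eq_zero _ _ h1 h2, cross_eq_zero, add_zero]
  · exact fun h => h3 (eq_sub_of_add_eq h.symm)
  · exact fun h => h4 (eq_sub_of_add_eq h.symm)

/-- A finite component off `K` of the dual graph has an even number of cut edges to `K`. -/
theorem IsPlanarDual.cutParity_eq_zero (hGH : IsPlanarDual G H) {s : ℤ × ℤ → ZMod 2}
    (hs : ∀ u v, G.Adj u v → s u = s v) {K L : Finset (ℤ × ℤ)}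
    (hL : ∀ q ∈ K, neighbours q ⊆ L)
    (D : (restrictTo H (K : Set (ℤ × ℤ))ᶜ).ConnectedComponent) [DecidablePred (· ∈ D.supp)]
    (hDK : ∀ p ∈ D.supp, p ∉ K) (hD : D.supp.Finite) : cutParity K L D.supp s = 0 := by
  classical
  let E : Finset (ℤ × ℤ) := hD.toFinset
  have hE : ∀ p, p ∈ E ↔ p ∈ D.supp := fun p => hD.mem_toFinset
  let M : Finset (ℤ × ℤ) := E ∪ K ∪ E.biUnion neighbours
  -- Sum the even degrees over the component. Cut edges inside it count twice, and all the others
  -- lead to `K`, because cut edges are edges of `H`.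
  have h0 : ∑ p ∈ E, ∑ q ∈ M, symmCut s p q = 0 := Finset.sum_eq_zero fun p hp =>
    sum_symmCut s ((Finset.subset_biUnion_of_mem neighbours hp).trans Finset.subset_union_right)
  have h1 : ∀ p ∈ E, ∑ q ∈ M, symmCut s p q =
      ∑ q ∈ E, symmCut s p q + ∑ q ∈ K, symmCut s p q := by
    intro p hp
    have hdisj : Disjoint E K := Finset.disjoint_left.2 fun x hx => hDK x ((hE x).1 hx)
    rw [← Finset.sum_union hdisj]
    refine (Finset.sum_subset Finset.subset_union_left fun q _ hq => ?_).symm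
    by_contra hne
    have hadj := hGH.adj_of_symmCut_ne_zero hs hne
    rw [Finset.mem_union, not_or] at hq
    refine hq.1 ((hE q).2 ?_)
    have hpD := (hE p).1 hp
    have hpq : (restrictTo H (K : Set (ℤ × ℤ))ᶜ).Adj p q := ⟨hadj, hDK p hpD, hq.2⟩
    rw [SimpleGraph.ConnectedComponent.mem_supp_iff] at hpD ⊢
    rw [← hpD]
    exact SimpleGraph.ConnectedComponent.sound hpq.symm.reachable
  have h2 : ∑ p ∈ E, ∑ q ∈ E, symmCut s p q = 0 := by
    simp only [symmCut, Finset.sum_add_distrib]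
    rw [Finset.sum_comm (f := fun p q => cut s q p)]
    exact zmod_two_add_self _
  rw [Finset.sum_congr rfl h1, Finset.sum_add_distrib, h2, zero_add] at h0
  rw [← h0, cutParity]
  have hsub : (L \ K).filter (· ∈ D.supp) ⊆ E := fun p hp => (hE p).2 (Finset.mem_filter.1 hp).2
  refine (Finset.sum_congr rfl fun p _ => Finset.sum_congr rfl fun q _ =>
    symmCut_comm s q p).trans (Finset.sum_subset hsub ?_)
  intro p hp hp'
  refine Finset.sum_eq_zero fun q hq => ?_
  rw [symmCut_comm]
  refine symmCut_eq_zero_of_notMem fun hpq => hp' (Finset.mem_filter.2 ⟨?_, (hE p).1 hp⟩)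
  exact Finset.mem_sdiff.2 ⟨hL q hq hpq, hDK p ((hE p).1 hp)⟩

/-- If a union of clusters of `G` separates two infinite clusters, then some component off `K` of
the dual graph has an odd number of cut edges to `K`. -/
theorem IsPlanarDual.exists_cutParity_ne_zero (hGH : IsPlanarDual G H) {s : ℤ × ℤ → ZMod 2}
    (hs : ∀ u v, G.Adj u v → s u = s v) {K L : Finset (ℤ × ℤ)}
    (hL : ∀ q ∈ K, neighbours q ⊆ L) {a b : ℤ × ℤ} (ha : {v | G.Reachable a v}.Infinite)
    (hb : {v | G.Reachable b v}.Infinite) (hab : s a + s b ≠ 0) {h v : ℤ × ℤ → ZMod 2}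
    (hbd : boundary h v = Pi.single a 1 + Pi.single b 1)
    (hK : ∀ q p, cross h v q p ≠ 0 → q ∈ K ∧ p ∈ K)
    (hpair : ∑ q ∈ K, ∑ p ∈ K, cross h v q p * cut s q p = s a + s b) :
    ∃ p ∈ L \ K, ∀ [DecidablePred
      (· ∈ ((restrictTo H (K : Set (ℤ × ℤ))ᶜ).connectedComponentMk p).supp)],
      cutParity K L ((restrictTo H (K : Set (ℤ × ℤ))ᶜ).connectedComponentMk p).supp s ≠ 0 := by
  classical
  obtain ⟨ha', va', hsa, hba⟩ := exists_chain_to_infinity hGH.le ha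
  obtain ⟨hb', vb', hsb, hbb⟩ := exists_chain_to_infinity hGH.le hb
  have hcycle : boundary (ha' + hb' + h) (va' + vb' + v) = 0 := by
    rw [boundary_add, boundary_add, hba, hbb, hbd]
    ext p
    exact zmod_two_add_self _
  obtain ⟨σ, hσr, hσu⟩ := exists_potential hcycle
  have hray := hsa.add hsb
  -- `σ` jumps only across open edges of `G` and across the edges of the chain `(h, v)`
  have hjump : ∀ q p, (p = q + (1, 0) ∨ p = q + (0, 1)) → H.Adj q p →
      σ q + σ p = cross h v q p := by
    rintro q p (rfl | rfl) hH
    · have : (va' + vb') (q + (1, 0)) = 0 := by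
        by_contra hne
        exact (hGH.right q).1 (hray.2 _ hne) hH
      rw [hσr, cross_right, Pi.add_apply, this, zero_add]
    · have : (ha' + hb') (q + (0, 1)) = 0 := by
        by_contra hne
        exact (hGH.up q).1 (hray.1 _ hne) hH
      rw [hσu, cross_up, Pi.add_apply, this, zero_add]
  have hσ_adj : ∀ q p, H.Adj q p → (q ∉ K ∨ p ∉ K) → σ q = σ p := by
    have key : ∀ q p, (p = q + (1, 0) ∨ p = q + (0, 1)) → H.Adj q p → (q ∉ K ∨ p ∉ K) →
        σ q = σ p := by
      intro q p hqp hH hout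
      have h1 := hjump q p hqp hH
      have h2 : cross h v q p = 0 := by
        by_contra hne
        exact hout.elim (fun h => h (hK q p hne).1) (fun h => h (hK q p hne).2)
      rw [h2] at h1
      linear_combination h1 - zmod_two_add_self (σ p)
    intro q p hH hout
    rcases (squareLattice_adj_iff q p).1 (hGH.dual_le hH) with h1 | h1 | h1 | h1
    · exact key q p (Or.inl h1) hH hout
    · exact key q p (Or.inr h1) hH hout
    · exact (key p q (Or.inl h1) hH.symm hout.symm).symm
    · exact (key p q (Or.inr h1) hH.symm hout.symm).symm
  have hσ_comp : ∀ p p', (restrictTo H (K : Set (ℤ × ℤ))ᶜ).Reachable p p' → σ p = σ p' := by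
    intro p p' hr
    refine reachable_induction (P := fun p' => σ p = σ p') hr rfl fun x y _ hxy hx => ?_
    exact hx.trans (hσ_adj x y hxy.1 (Or.inl hxy.2.1))
  -- Across a cut edge, which is open in `H`, the rays have coefficient zero, so `σ` jumps exactly
  -- by the path's coefficient.
  have hmul : ∀ q p, (σ q + σ p) * cut s q p = cross h v q p * cut s q p := by
    intro q p
    by_cases h0 : cut s q p = 0
    · rw [h0, mul_zero, mul_zero]
    · have hqp : p = q + (1, 0) ∨ p = q + (0, 1) := by
        by_contra hne
        rw [not_or] at hne
        exact h0 (cross_eq_zero _ _ hne.1 hne.2)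
      have h1 : cut s p q = 0 := by
        refine cross_eq_zero _ _ ?_ ?_ <;> rcases hqp with rfl | rfl <;>
          simp only [ne_eq, Prod.ext_iff, Prod.fst_add, Prod.snd_add] <;> omega
      rw [hjump q p hqp (hGH.adj_of_symmCut_ne_zero hs (by simpa [symmCut, h1] using h0))]
  have hKK : ∑ q ∈ K, ∑ p ∈ K, σ q * symmCut s q p = s a + s b := by
    simp only [symmCut, sum_sum_symmetrized, hmul, hpair]
  -- The total cut degree of each `q ∈ K` is even, so the edges leaving `K` carry the same sum as
  -- those inside.
  have hKL : ∑ q ∈ K, ∑ p ∈ L \ K, σ q * symmCut s q p = s a + s b := by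
    have hall : ∑ q ∈ K, ∑ p ∈ K ∪ L \ K, σ q * symmCut s q p = 0 := by
      refine Finset.sum_eq_zero fun q hq => ?_
      rw [← Finset.mul_sum, sum_symmCut, mul_zero]
      intro p hp
      by_cases hpK : p ∈ K
      · exact Finset.mem_union_left _ hpK
      · exact Finset.mem_union_right _ (Finset.mem_sdiff.2 ⟨hL q hq hp, hpK⟩)
    simp only [Finset.sum_union Finset.disjoint_sdiff, Finset.sum_add_distrib, hKK] at hall
    linear_combination hall - zmod_two_add_self (s a + s b)
  have hgroup : ∑ p ∈ L \ K, σ p * ∑ q ∈ K, symmCut s q p ≠ 0 := by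
    rw [← hKL, Finset.sum_comm] at hab
    refine ne_of_eq_of_ne (Finset.sum_congr rfl fun p hp => ?_) hab
    rw [Finset.mul_sum]
    refine Finset.sum_congr rfl fun q _ => ?_
    by_cases h0 : symmCut s q p = 0
    · rw [h0, mul_zero, mul_zero]
    · rw [hσ_adj q p (hGH.adj_of_symmCut_ne_zero hs h0) (Or.inr (Finset.mem_sdiff.1 hp).2)]
  by_contra! hcon
  refine hgroup ?_
  let comp : ℤ × ℤ → (restrictTo H (K : Set (ℤ × ℤ))ᶜ).ConnectedComponent :=
    fun p => (restrictTo H (K : Set (ℤ × ℤ))ᶜ).connectedComponentMk p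
  -- As `σ` is constant on components off `K`, the sum is a combination of their parities; if all
  -- were zero, so would be the sum.
  rw [← Finset.sum_fiberwise_of_maps_to
    (fun p hp => Finset.mem_image_of_mem comp hp)]
  refine Finset.sum_eq_zero fun D hD => ?_
  obtain ⟨p₀, hp₀, rfl⟩ := Finset.mem_image.1 hD
  obtain ⟨hdec, h0⟩ := hcon p₀ hp₀
  have hσc : ∀ p ∈ (L \ K).filter (fun p => comp p = comp p₀),
      σ p * ∑ q ∈ K, symmCut s q p = σ p₀ * ∑ q ∈ K, symmCut s q p := by
    intro p hp
    rw [hσ_comp p p₀ (SimpleGraph.ConnectedComponent.exact (Finset.mem_filter.1 hp).2)]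
  rw [Finset.sum_congr rfl hσc, ← Finset.mul_sum]
  have h1 : ∑ p ∈ (L \ K).filter (fun p => comp p = comp p₀), ∑ q ∈ K, symmCut s q p = 0 := by
    rw [← h0]
    refine Finset.sum_congr (Finset.ext fun x => ?_) fun _ _ => rfl
    rw [Finset.mem_filter, Finset.mem_filter]
    rfl
  rw [h1, mul_zero]

/-- If `G` has more than `N` infinite clusters, then the dual graph has at least `N` infinite
components off some finite set. -/
theorem IsPlanarDual.exists_infinite_components (hGH : IsPlanarDual G H) {N : ℕ}
    (b : Fin (N + 1) → ℤ × ℤ) (hinf : ∀ i, {v | G.Reachable (b i) v}.Infinite)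
    (hne : ∀ i j, i ≠ j → ¬ G.Reachable (b i) (b j)) :
    ∃ (K : Finset (ℤ × ℤ)) (T : Finset (restrictTo H (K : Set (ℤ × ℤ))ᶜ).ConnectedComponent),
      (∀ D ∈ T, D.supp.Infinite) ∧ N ≤ T.card := by
  classical
  have hlattice : ∀ u v : ℤ × ℤ, squareLattice.Reachable u v := by
    have hx : ∀ x y n : ℤ, squareLattice.Reachable (x, y) (x + n, y) := by
      intro x y n
      induction n using Int.induction_on with
      | zero => simp
      | succ n ih =>
        refine ih.trans (SimpleGraph.Adj.reachable ?_)
        rw [squareLattice_adj]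
        simp [add_assoc]
      | pred n ih =>
        refine ih.trans (SimpleGraph.Adj.reachable ?_)
        rw [squareLattice_adj]
        simp only [true_and]
        omega
    have hy : ∀ x y n : ℤ, squareLattice.Reachable (x, y) (x, y + n) := by
      intro x y n
      induction n using Int.induction_on with
      | zero => simp
      | succ n ih =>
        refine ih.trans (SimpleGraph.Adj.reachable ?_)
        rw [squareLattice_adj]
        simp [add_assoc]
      | pred n ih =>
        refine ih.trans (SimpleGraph.Adj.reachable ?_)
        rw [squareLattice_adj]
        simp only [true_and]
        omega
    rintro ⟨u1, u2⟩ ⟨v1, v2⟩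
    have h1 := hx u1 u2 (v1 - u1)
    have h2 := hy v1 u2 (v2 - u2)
    rw [add_sub_cancel] at h1 h2
    exact h1.trans h2
  choose h v hsupp hbd F hF hpair using fun i : Fin N =>
    exists_chain_of_reachable le_rfl (hlattice (b 0) (b i.succ))
  let K : Finset (ℤ × ℤ) := Finset.univ.biUnion F
  have hFK : ∀ i, F i ⊆ K := fun i => Finset.subset_biUnion_of_mem F (Finset.mem_univ i)
  let L : Finset (ℤ × ℤ) := K.biUnion neighbours
  have hL : ∀ q ∈ K, neighbours q ⊆ L := fun q hq => Finset.subset_biUnion_of_mem neighbours hq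
  let comp : ℤ × ℤ → (restrictTo H (K : Set (ℤ × ℤ))ᶜ).ConnectedComponent :=
    fun p => (restrictTo H (K : Set (ℤ × ℤ))ᶜ).connectedComponentMk p
  let T := ((L \ K).image comp).filter fun D => D.supp.Infinite
  refine ⟨K, T, fun D hD => (Finset.mem_filter.1 hD).2, ?_⟩
  by_contra! hlt
  -- The indicator of the union of the clusters selected by `c`. The cluster of `b 0` is never
  -- selected and serves as the base point.
  let S : (Fin N → ZMod 2) → ℤ × ℤ → ZMod 2 :=
    fun c u => ∑ i, c i * if G.Reachable (b i.succ) u then 1 else 0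
  have hS_add : ∀ c c', S (c + c') = S c + S c' := by
    intro c c'
    ext u
    simp only [S, Pi.add_apply, add_mul, Finset.sum_add_distrib]
  let φ₀ : (Fin N → ZMod 2) →+ (T → ZMod 2) :=
    AddMonoidHom.mk' (fun c D => cutParity K L D.1.supp (S c)) fun c c' => by
      ext D
      simp only [hS_add, cutParity_add, Pi.add_apply]
  let φ : (Fin N → ZMod 2) →ₗ[ZMod 2] (T → ZMod 2) := φ₀.toZModLinearMap 2
  -- Fewer than `N` infinite components impose fewer than `N` parity conditions on `N` unknowns.
  have hker : LinearMap.ker φ ≠ ⊥ := LinearMap.ker_ne_bot_of_finrank_lt (by simpa using hlt)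
  obtain ⟨c, hc, hc0⟩ := (Submodule.ne_bot_iff _).1 hker
  obtain ⟨i, hi⟩ := Function.ne_iff.1 hc0
  have hs : ∀ u w, G.Adj u w → S c u = S c w := by
    intro u w huw
    refine Finset.sum_congr rfl fun i _ => ?_
    have : G.Reachable (b i.succ) u ↔ G.Reachable (b i.succ) w :=
      ⟨fun h => h.trans huw.reachable, fun h => h.trans huw.symm.reachable⟩
    simp only [this]
  have hS0 : S c (b 0) = 0 := Finset.sum_eq_zero fun j _ => by
    rw [if_neg (hne _ _ (Fin.succ_ne_zero j)), mul_zero]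
  have hSi : S c (b i.succ) = c i := by
    simp only [S]
    rw [Finset.sum_eq_single_of_mem i (Finset.mem_univ i)]
    · rw [if_pos (SimpleGraph.Reachable.refl _), mul_one]
    · intro j _ hji
      rw [if_neg (hne _ _ fun h => hji (Fin.succ_injective _ h)), mul_zero]
  obtain ⟨p, hp, hpar⟩ := hGH.exists_cutParity_ne_zero hs hL (hinf 0) (hinf i.succ)
    (by rw [hS0, hSi, zero_add]; exact hi) (hbd i)
    (fun q p hqp => ⟨hFK i (hF i q p hqp).1, hFK i (hF i q p hqp).2⟩)
    (hpair i K (hFK i) (S c))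
  have hpK : p ∉ (K : Set (ℤ × ℤ)) := (Finset.mem_sdiff.1 hp).2
  have hinfp : (comp p).supp.Infinite := by
    intro hfin
    refine hpar (hGH.cutParity_eq_zero hs hL _ (fun x hx => ?_) hfin)
    exact mem_of_reachable_restrictTo (S := (K : Set (ℤ × ℤ))ᶜ) hpK
      (SimpleGraph.ConnectedComponent.exact hx).symm
  have hpT : comp p ∈ T := Finset.mem_filter.2 ⟨Finset.mem_image_of_mem comp hp, hinfp⟩
  exact hpar (congrFun (LinearMap.mem_ker.1 hc) ⟨comp p, hpT⟩)

end Planar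

/-! ### Comparing infinite clusters of a graph and its dual -/

section Planar

variable {G H : SimpleGraph (ℤ × ℤ)}

theorem finite_setOf_adj (hH : H ≤ squareLattice) (v : ℤ × ℤ) : {w | H.Adj v w}.Finite := by
  refine (neighbours v).finite_toSet.subset fun w hw => ?_
  have := (squareLattice_adj_iff v w).1 (hH hw)
  simp only [neighbours, Finset.coe_insert, Finset.coe_singleton, Set.mem_insert_iff,
    Set.mem_singleton_iff, eq_sub_iff_add_eq]
  rcases this with h | h | h | h <;> simp [h]

/-- Without branching sets, a finite set splits each infinite cluster into at most two infinite
components. -/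
theorem card_le_of_not_branching (hH : H ≤ squareLattice) (hbr : ∀ J, ¬ Branching H J)
    (hfin : {C : H.ConnectedComponent | C.supp.Infinite}.Finite) (K : Finset (ℤ × ℤ))
    (T : Finset (restrictTo H (K : Set (ℤ × ℤ))ᶜ).ConnectedComponent)
    (hT : ∀ D ∈ T, D.supp.Infinite) : T.card ≤ 2 * hfin.toFinset.card := by
  classical
  have hle := restrictTo_le H (K : Set (ℤ × ℤ))ᶜ
  let f : (restrictTo H (K : Set (ℤ × ℤ))ᶜ).ConnectedComponent → H.ConnectedComponent :=
    SimpleGraph.ConnectedComponent.map (SimpleGraph.Hom.ofLE hle)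
  have hout : ∀ D : (restrictTo H (K : Set (ℤ × ℤ))ᶜ).ConnectedComponent,
      (restrictTo H (K : Set (ℤ × ℤ))ᶜ).connectedComponentMk D.out = D := fun D => Quot.out_eq D
  have hfout : ∀ D : (restrictTo H (K : Set (ℤ × ℤ))ᶜ).ConnectedComponent,
      f D = H.connectedComponentMk D.out := by
    intro D
    conv_lhs => rw [← hout D]
    rfl
  have hsupp : ∀ D : (restrictTo H (K : Set (ℤ × ℤ))ᶜ).ConnectedComponent,
      D.supp = {v | (restrictTo H (K : Set (ℤ × ℤ))ᶜ).Reachable D.out v} := by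
    intro D
    ext v
    rw [SimpleGraph.ConnectedComponent.mem_supp_iff, Set.mem_ofPred_eq]
    conv_lhs => rw [← hout D]
    rw [SimpleGraph.ConnectedComponent.eq]
    exact SimpleGraph.reachable_comm
  have hmaps : ∀ D ∈ T, f D ∈ hfin.toFinset := by
    intro D hD
    rw [hfin.mem_toFinset]
    refine (hT D hD).mono fun v hv => ?_
    rw [SimpleGraph.ConnectedComponent.mem_supp_iff] at hv ⊢
    rw [← hv]
    rfl
  -- Each component off `K` lies in one cluster; three in the same cluster would yield a branching
  -- set.
  refine Finset.card_le_mul_card_image_of_maps_to hmaps 2 fun C _ => ?_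
  by_contra! hcard
  obtain ⟨A, B, D, hA, hB, hD, hAB, hAD, hBD⟩ := Finset.two_lt_card_iff.1 hcard
  rw [Finset.mem_filter] at hA hB hD
  let c : Fin 3 → (restrictTo H (K : Set (ℤ × ℤ))ᶜ).ConnectedComponent := ![A, B, D]
  have hc : ∀ i, c i ∈ T ∧ f (c i) = C := by
    intro i
    fin_cases i
    exacts [hA, hB, hD]
  have hcinj : ∀ i j, i ≠ j → c i ≠ c j := by
    intro i j hij
    fin_cases i <;> fin_cases j
    exacts [absurd rfl hij, hAB, hAD, hAB.symm, absurd rfl hij, hBD, hAD.symm, hBD.symm,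
      absurd rfl hij]
  obtain ⟨J, hJ⟩ := exists_branching (finite_setOf_adj hH) K (fun i => (c i).out)
    (fun i => SimpleGraph.ConnectedComponent.exact
      (by rw [← hfout, ← hfout, (hc 0).2, (hc i).2]))
    (fun i => hsupp (c i) ▸ hT _ (hc i).1)
    (fun i j hij h => hcinj i j hij
      (by rw [← hout (c i), ← hout (c j), SimpleGraph.ConnectedComponent.sound h]))
  exact hbr J hJ

/-- If `H` had only `M` infinite clusters, then `2 * M + 2` infinite clusters of `G` would force `2
* M + 1` infinite components off a finite set, against the bound `2 * M`. -/
theorem IsPlanarDual.infinite_of_infinite (hGH : IsPlanarDual G H) (hbr : ∀ J, ¬ Branching H J)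
    (hG : {C : G.ConnectedComponent | C.supp.Infinite}.Infinite) :
    {C : H.ConnectedComponent | C.supp.Infinite}.Infinite := by
  intro hfin
  let e := hG.natEmbedding
  have hout : ∀ C : G.ConnectedComponent, G.connectedComponentMk C.out = C :=
    fun C => Quot.out_eq C
  obtain ⟨K, T, hT, hcard⟩ := hGH.exists_infinite_components
    (N := 2 * hfin.toFinset.card + 1) (fun i => (e i).1.out)
    (fun i => by
      refine (e i).2.mono fun v hv => ?_
      rw [SimpleGraph.ConnectedComponent.mem_supp_iff, ← hout (e i).1] at hv
      exact (SimpleGraph.ConnectedComponent.exact hv).symm)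
    (fun i j hij h => hij (Fin.ext (e.injective (Subtype.ext (by
      rw [← hout (e i).1, ← hout (e j).1, SimpleGraph.ConnectedComponent.sound h])))))
  have := card_le_of_not_branching hGH.dual_le hbr hfin K T hT
  omega

end Planar

/-! ### Application to random configurations -/

section Lattice

theorem infinite_components_iff {V W : Type*} {G : SimpleGraph V} {H : SimpleGraph W} (f : G ≃g H) :
    {C : G.ConnectedComponent | C.supp.Infinite}.Infinite ↔
      {C : H.ConnectedComponent | C.supp.Infinite}.Infinite := by
  have key : ∀ C : G.ConnectedComponent,
      (f.connectedComponentEquiv C).supp.Infinite ↔ C.supp.Infinite := by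
    intro C
    have : (f.connectedComponentEquiv C).supp = f '' C.supp := by
      ext w
      obtain ⟨v, rfl⟩ := f.surjective w
      rw [f.injective.mem_set_image]
      induction C using SimpleGraph.ConnectedComponent.ind with
      | h u =>
        rw [SimpleGraph.ConnectedComponent.mem_supp_iff,
          SimpleGraph.ConnectedComponent.mem_supp_iff, SimpleGraph.ConnectedComponent.eq]
        change H.connectedComponentMk (f v) = H.connectedComponentMk (f u) ↔ _
        rw [SimpleGraph.ConnectedComponent.eq]
        exact f.reachable_iff
    rw [this, Set.infinite_image_iff f.injective.injOn]
  rw [← Set.infinite_image_iff (f := f.connectedComponentEquiv)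
    f.connectedComponentEquiv.injective.injOn]
  refine iff_of_eq (congrArg _ ?_)
  ext D
  obtain ⟨C, rfl⟩ := f.connectedComponentEquiv.surjective D
  rw [f.connectedComponentEquiv.injective.mem_set_image]
  exact (key C).symm

/-- For a translation-invariant random graph whose dual is translation-invariant too: if it has
infinitely many infinite clusters with positive probability, then so has its dual. -/
theorem measure_infinite_components_ne_zero {Ω : Type*} [MeasurableSpace Ω] (μ : Measure Ω)
    [IsProbabilityMeasure μ] (X Y : Ω → SimpleGraph (ℤ × ℤ))
    (hXY : ∀ ω, IsPlanarDual (X ω) (Y ω))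
    (hY : ∀ u v, Measurable fun ω => (Y ω).Adj u v)
    (τ : ℤ × ℤ → Ω → Ω) (hτ : ∀ t, MeasurePreserving (τ t) μ μ)
    (hYτ : ∀ t ω u v, (Y (τ t ω)).Adj u v ↔ (Y ω).Adj (u - t) (v - t))
    (h : μ {ω | {C : (X ω).ConnectedComponent | C.supp.Infinite}.Infinite} ≠ 0) :
    μ {ω | {C : (Y ω).ConnectedComponent | C.supp.Infinite}.Infinite} ≠ 0 := by
  intro h0
  refine h ?_
  have hbr := ae_not_branching μ Y hY (fun ω => (hXY ω).dual_le) τ hτ hYτ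
  have hfin : ∀ᵐ ω ∂μ, ¬ {C : (Y ω).ConnectedComponent | C.supp.Infinite}.Infinite := by
    rw [ae_iff]
    simpa using h0
  have : ∀ᵐ ω ∂μ, ¬ {C : (X ω).ConnectedComponent | C.supp.Infinite}.Infinite := by
    filter_upwards [hbr, hfin] with ω h1 h2 h3
    exact h2 ((hXY ω).infinite_of_infinite h1 h3)
  rw [ae_iff] at this
  simpa using this

theorem openSubgraph_adj {V : Type*} {G : SimpleGraph V} (ω : Config G) (u v : V) :
    (openSubgraph ω).Adj u v ↔ ∃ h : G.Adj u v, ω ⟨s(u, v), h⟩ = true := by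
  rw [openSubgraph, SimpleGraph.fromEdgeSet_adj]
  constructor
  · rintro ⟨⟨h, hω⟩, -⟩
    exact ⟨h, hω⟩
  · rintro ⟨h, hω⟩
    exact ⟨⟨h, hω⟩, h.ne⟩

theorem openSubgraph_le {V : Type*} {G : SimpleGraph V} (ω : Config G) : openSubgraph ω ≤ G :=
  fun u v h => ((openSubgraph_adj ω u v).1 h).1

theorem measurable_openSubgraph_adj {V Ω : Type*} [MeasurableSpace Ω] {G : SimpleGraph V}
    {f : Ω → Config G} (hf : Measurable f) (u v : V) :
    Measurable fun ω => (openSubgraph (f ω)).Adj u v := by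
  by_cases h : G.Adj u v
  · have : (fun ω => (openSubgraph (f ω)).Adj u v) = fun ω => f ω ⟨s(u, v), h⟩ = true := by
      ext ω
      rw [openSubgraph_adj]
      exact ⟨fun ⟨_, h⟩ => h, fun h' => ⟨h, h'⟩⟩
    rw [this]
    have h1 : Measurable fun ω => f ω ⟨s(u, v), h⟩ := (measurable_pi_apply _).comp hf
    exact (measurable_of_countable fun b : Bool => b = true).comp h1
  · have : (fun ω => (openSubgraph (f ω)).Adj u v) = fun _ => False := by
      ext ω
      exact iff_of_false (fun h' => h (openSubgraph_le _ h')) id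
    rw [this]
    exact measurable_const

theorem squareLattice_adj_sub (t u v : ℤ × ℤ) :
    squareLattice.Adj (u - t) (v - t) ↔ squareLattice.Adj u v := by
  rw [squareLattice_adj, squareLattice_adj]
  simp only [Prod.fst_sub, Prod.snd_sub]
  omega

theorem openSubgraph_translate_adj (t : ℤ × ℤ) (ω : Config squareLattice) (u v : ℤ × ℤ) :
    (openSubgraph (translate t ω)).Adj u v ↔ (openSubgraph ω).Adj (u - t) (v - t) := by
  rw [openSubgraph_adj, openSubgraph_adj]
  have key : ∀ (h : squareLattice.Adj u v) (h' : squareLattice.Adj (u - t) (v - t)),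
      translate t ω ⟨s(u, v), h⟩ = ω ⟨s(u - t, v - t), h'⟩ := by
    intro h h'
    refine congrArg ω ((Equiv.symm_apply_eq _).2 (Subtype.ext ?_))
    change s(u, v) = s(u - t + t, v - t + t)
    rw [sub_add_cancel, sub_add_cancel]
  constructor
  · rintro ⟨h, hω⟩
    exact ⟨(squareLattice_adj_sub t u v).2 h, (key h _).symm.trans hω⟩
  · rintro ⟨h, hω⟩
    exact ⟨(squareLattice_adj_sub t u v).1 h, (key _ h).trans hω⟩

theorem openSubgraph_dualConfig_adj (ω : Config squareLattice) (q p : ℤ × ℤ) :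
    (openSubgraph (dualConfig ω)).Adj q p ↔ squareLattice.Adj q p ∧
      ¬ (openSubgraph ω).Adj (q ⊔ p) (q ⊓ p + (1, 1)) := by
  rw [openSubgraph_adj, openSubgraph_adj, ← dualLattice_adj]
  have hprimal : ∀ h : dualLattice.Adj q p, squareLattice.Adj (q ⊔ p) (q ⊓ p + (1, 1)) :=
    fun h => (dualEdge.symm ⟨s(q, p), h⟩).2
  have key : ∀ (h : dualLattice.Adj q p) (h' : squareLattice.Adj (q ⊔ p) (q ⊓ p + (1, 1))),
      dualConfig ω ⟨s(q, p), h⟩ = !ω ⟨s(q ⊔ p, q ⊓ p + (1, 1)), h'⟩ := fun _ _ => rfl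
  constructor
  · rintro ⟨h, hω⟩
    refine ⟨h, fun ⟨h', hω'⟩ => ?_⟩
    rw [key h h', hω'] at hω
    exact absurd hω (by decide)
  · rintro ⟨h, hω⟩
    refine ⟨h, ?_⟩
    rw [key h (hprimal h), Bool.not_eq_true', ← Bool.not_eq_true]
    exact fun hω' => hω ⟨hprimal h, hω'⟩

/-- Duality commutes with translations, so Burton–Keane applies to the dual graph under the original
measure. -/
theorem openSubgraph_dualConfig_translate_adj (t : ℤ × ℤ) (ω : Config squareLattice)
    (q p : ℤ × ℤ) : (openSubgraph (dualConfig (translate t ω))).Adj q p ↔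
      (openSubgraph (dualConfig ω)).Adj (q - t) (p - t) := by
  rw [openSubgraph_dualConfig_adj, openSubgraph_dualConfig_adj, openSubgraph_translate_adj,
    squareLattice_adj_sub]
  have h1 : (q - t) ⊔ (p - t) = q ⊔ p - t := by
    ext
    · exact max_sub_sub_right _ _ _
    · exact max_sub_sub_right _ _ _
  have h2 : (q - t) ⊓ (p - t) + (1, 1) = q ⊓ p + (1, 1) - t := by
    rw [add_sub_right_comm]
    congr 1
    ext
    · exact min_sub_sub_right _ _ _
    · exact min_sub_sub_right _ _ _
  rw [h1, h2]

theorem isPlanarDual_dualConfig (ω : Config squareLattice) :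
    IsPlanarDual (openSubgraph ω) (openSubgraph (dualConfig ω)) where
  le := openSubgraph_le ω
  dual_le := fun _ _ h => ((openSubgraph_dualConfig_adj ω _ _).1 h).1
  right q := by
    have h1 : q ⊔ (q + (1, 0)) = q + (1, 0) := sup_eq_right.2 (by simp [Prod.le_def])
    have h2 : q ⊓ (q + (1, 0)) = q := inf_eq_left.2 (by simp [Prod.le_def])
    have h3 : q + (1, 0) + (0, 1) = q + (1, 1) := by rw [add_assoc]; rfl
    have h4 : squareLattice.Adj q (q + (1, 0)) := (squareLattice_adj_iff _ _).2 (Or.inl rfl)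
    rw [openSubgraph_dualConfig_adj, h1, h2, h3, and_iff_right h4, not_not]
  up q := by
    have h1 : q ⊔ (q + (0, 1)) = q + (0, 1) := sup_eq_right.2 (by simp [Prod.le_def])
    have h2 : q ⊓ (q + (0, 1)) = q := inf_eq_left.2 (by simp [Prod.le_def])
    have h3 : q + (0, 1) + (1, 0) = q + (1, 1) := by rw [add_assoc]; rfl
    have h4 : squareLattice.Adj q (q + (0, 1)) :=
      (squareLattice_adj_iff _ _).2 (Or.inr (Or.inl rfl))
    rw [openSubgraph_dualConfig_adj, h1, h2, h3, and_iff_right h4, not_not]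

/-- The dual of the dual is the original graph, up to a translation by `(1, 1)`. -/
theorem IsPlanarDual.symm {G H : SimpleGraph (ℤ × ℤ)} (hGH : IsPlanarDual G H) :
    IsPlanarDual (H.comap (Equiv.subRight ((1 : ℤ), (1 : ℤ)))) G where
  le := fun u v h => (squareLattice_adj_sub (1, 1) u v).1 (hGH.dual_le h)
  dual_le := hGH.le
  right q := by
    have h := hGH.up (q - (0, 1))
    rw [sub_add_cancel] at h
    have h1 : q + (1, 0) - (1, 1) = q - (0, 1) := by ext <;> simp
    have h2 : q + (1, 0) + (0, 1) - (1, 1) = q := by ext <;> simp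
    rw [h, not_not, SimpleGraph.comap_adj, Equiv.subRight_apply, Equiv.subRight_apply, h1, h2]
  up q := by
    have h := hGH.right (q - (1, 0))
    rw [sub_add_cancel] at h
    have h1 : q + (0, 1) - (1, 1) = q - (1, 0) := by ext <;> simp
    have h2 : q + (0, 1) + (1, 0) - (1, 1) = q := by ext <;> simp
    rw [h, not_not, SimpleGraph.comap_adj, Equiv.subRight_apply, Equiv.subRight_apply, h1, h2]

/-- Duality as a measurable equivalence of configuration spaces. -/
def dualConfigEquiv : Config squareLattice ≃ᵐ Config dualLattice where
  toFun := dualConfig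
  invFun η e := !η (dualEdge e)
  left_inv ω := by
    ext e
    simp [dualConfig]
  right_inv η := by
    ext f
    simp [dualConfig]
  measurable_toFun := measurable_dualConfig
  measurable_invFun := measurable_pi_lambda _ fun e =>
    (measurable_of_countable Bool.not).comp (measurable_pi_apply (dualEdge e))

/-- Because duality is a measurable equivalence, `S` need not be measurable; measurability of the
event of infinitely many infinite clusters is thus never needed. -/
theorem dualMeasure_apply (μ : Measure (Config squareLattice)) (S : Set (Config dualLattice)) :
    dualMeasure μ S = μ (dualConfig ⁻¹' S) :=
  dualConfigEquiv.map_apply S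

end Lattice
end Percolation

theorem lemma2p5 (μ : MeasureTheory.Measure (Percolation.Config Percolation.squareLattice))
    [MeasureTheory.IsProbabilityMeasure μ] (hμ : Percolation.TranslationInvariant μ) :
    0 < μ {ω | Percolation.HasInfinitelyManyInfiniteClusters ω} ↔
      0 < Percolation.dualMeasure μ {η | Percolation.HasInfinitelyManyInfiniteClusters η} := by
  open Percolation in
  rw [dualMeasure_apply, pos_iff_ne_zero, pos_iff_ne_zero]
  constructor
  · exact measure_infinite_components_ne_zero μ (fun ω => openSubgraph ω)
      (fun ω => openSubgraph (dualConfig ω)) isPlanarDual_dualConfig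
      (measurable_openSubgraph_adj measurable_dualConfig) translate hμ
      openSubgraph_dualConfig_translate_adj
  · intro h
    -- The roles are exchanged: the shifted dual is now the primal graph, and the original graph its
    -- dual. The shift preserves the number of infinite clusters.
    refine measure_infinite_components_ne_zero μ
      (fun ω => (openSubgraph (dualConfig ω)).comap (Equiv.subRight ((1 : ℤ), (1 : ℤ))))
      (fun ω => openSubgraph ω) (fun ω => (isPlanarDual_dualConfig ω).symm)
      (measurable_openSubgraph_adj measurable_id) translate hμ openSubgraph_translate_adj ?_
    simp only [infinite_components_iff (SimpleGraph.Iso.comap _ _)]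
    exact h
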